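/- Let $(B^n,g_B)$ and $(F^m,g_F)$ be nonempty smooth semi-Riemannian manifolds without boundary, $m=\dim F\ge 1$, let $f:B\to(0,\infty)$ be smooth, and let $B\times_f F$ be the warped product, i.e. $B\times F$ with the metric $g=\pi^*g_B+(f\circ\pi)^2\sigma^*g_F$, where $\pi,\sigma$ are the projections onto $B$ and $F$. For a semi-Riemannian manifold $(M,g)$, smooth functions $h,u:M\to\mathbb{R}$, and constants $\theta\ge 0$, $\lambda\in\mathbb{R}$, call $(M,g,h,u,\lambda)$ a gradient Ricci-harmonic soliton (GRHS) with constant $\theta$ if $$\mathrm{Ric}_g+\mathrm{Hess}_g h-\theta\,\nabla u\otimes\nabla u=\lambda g,\qquad \Delta_g u-g(\nabla u,\nabla h)=0,$$ where $\nabla u\otimes\nabla u=du\otimes du$ and $\Delta_g=\mathrm{tr}_g\,\mathrm{Hess}_g$. Fix $\theta\ge 0$, $\lambda\in\mathbb{R}$ and a potential function of the form $h=h_B\circ\pi$ with $h_B\in C^\infty(B)$. (a) Let $u=u_B\circ\pi$ with $u_B\in C^\infty(B)$. Then $(B\times_f F,g,h,u,\lambda)$ is a GRHS with constant $\theta$ if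 and only if $$\mathrm{Ric}_{g_B}-\frac{m}{f}\mathrm{Hess}_{g_B}f+\mathrm{Hess}_{g_B}h_B-\theta\,\nabla u_B\otimes\nabla u_B=\lambda g_B,\qquad \Delta_\omega u_B=0\ \text{ on } B,$$ where $\omega=h_B-m\log f$ and $\Delta_\omega=\Delta_{g_B}-g_B(\nabla\omega,\nabla\,\cdot\,)$, and there is a constant $\mu\in\mathbb{R}$ such that $F$ is Einstein with $\mathrm{Ric}_{g_F}=\mu g_F$ and $$f\Delta_{g_B}f+(m-1)\,g_B(\nabla f,\nabla f)+\lambda f^2-f\,\nabla f(h_B)=\mu\quad\text{on } B.$$ (b) Let $u=u_F\circ\sigma$ with $u_F\in C^\infty(F)$. Then $(B\times_f F,g,h,u,\lambda)$ is a GRHS with constant $\theta$ if and only if $$\mathrm{Ric}_{g_B}-\frac{m}{f}\mathrm{Hess}_{g_B}f+\mathrm{Hess}_{g_B}h_B=\lambda g_B$$ and there is a constant $\mu\in\mathbb{R}$ such that $F$ is harmonic-Einstein, i.e. $\mathrm{Ric}_{g_F}-\theta\,\nabla u_F\otimes\nabla u_F=\mu g_F$ and $\Delta_{g_F}u_F=0$,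 and $$f\Delta_{g_B}f+(m-1)\,g_B(\nabla f,\nabla f)+\lambda f^2-f\,\nabla f(h_B)=\mu\quad\text{on } B.$$ -/

import Mathlib

open scoped Manifold ContDiff Bundle Topology

noncomputable section

/-! ## Local semi-Riemannian calculus on a finite-dimensional normed space

`G : E → E →L[ℝ] E →L[ℝ] ℝ` is a field of symmetric bilinear forms on (an open subset of) `E`:
the expression of a semi-Riemannian metric in a chart. Vectors `v : E` are regarded as constant
(coordinate) vector fields. -/

namespace LocalGeometry

variable {E : Type*} [NormedAddCommGroup E] [NormedSpace ℝ E]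

/-- The Christoffel symbols `Γ(v, w) = ∇_v w`. Where `G x` is nondegenerate, `Γ(v, w)` is the vector
determined by `G(Γ(v, w), z) = ½ (∂_v G(w, z) + ∂_w G(v, z) - ∂_z G(v, w))` for all `z`. -/
def christoffel (G : E → E →L[ℝ] E →L[ℝ] ℝ) (x v w : E) : E :=
  (G x).inverse ((1 / 2 : ℝ) • (fderiv ℝ (fun y ↦ G y w) x v + fderiv ℝ (fun y ↦ G y v) x w
    - fderiv ℝ (fun y ↦ G y v w) x))

/-- The curvature tensor `R(v, w) z`, where
`R(X, Y) Z = ∇_X ∇_Y Z - ∇_Y ∇_X Z - ∇_[X, Y] Z`. -/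
def curvature (G : E → E →L[ℝ] E →L[ℝ] ℝ) (x v w z : E) : E :=
  fderiv ℝ (fun y ↦ christoffel G y w z) x v - fderiv ℝ (fun y ↦ christoffel G y v z) x w
    + christoffel G x v (christoffel G x w z) - christoffel G x w (christoffel G x v z)

/-- The Hessian `(v, w) ↦ ∂_v ∂_w φ - (Γ(v, w)) φ`. -/
def hessian (G : E → E →L[ℝ] E →L[ℝ] ℝ) (φ : E → ℝ) (x v w : E) : ℝ :=
  fderiv ℝ (fun y ↦ fderiv ℝ φ y w) x v - fderiv ℝ φ x (christoffel G x v w)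

variable [FiniteDimensional ℝ E]

/-- The Ricci tensor `Ric(w, z) = tr (v ↦ R(v, w) z)`. -/
def ricci (G : E → E →L[ℝ] E →L[ℝ] ℝ) (x w z : E) : ℝ :=
  ∑ i, (Module.finBasis ℝ E).coord i (curvature G x (Module.finBasis ℝ E i) w z)

/-- The trace `∑ g^{ij} T(e_i, e_j)` of a bilinear form `T` with respect to a nondegenerate
symmetric bilinear form `g`; `g^{ij} = e^i (g⁻¹ e^j)` is the inverse matrix of `g(e_i, e_j)`. -/
def metricTrace (g : E →L[ℝ] E →L[ℝ] ℝ) (T : E → E → ℝ) : ℝ :=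
  ∑ i, ∑ j, (Module.finBasis ℝ E).coord i
      (g.inverse (LinearMap.toContinuousLinearMap ((Module.finBasis ℝ E).coord j))) *
    T (Module.finBasis ℝ E i) (Module.finBasis ℝ E j)

end LocalGeometry

/-! ## Semi-Riemannian metrics on manifolds -/

section Manifolds

variable {E : Type*} [NormedAddCommGroup E] [NormedSpace ℝ E]
  {H : Type*} [TopologicalSpace H] {I : ModelWithCorners ℝ E H}
  {M : Type*} [TopologicalSpace M] [ChartedSpace H M]
  {E' : Type*} [NormedAddCommGroup E'] [NormedSpace ℝ E']
  {H' : Type*} [TopologicalSpace H'] {I' : ModelWithCorners ℝ E' H'}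
  {M' : Type*} [TopologicalSpace M'] [ChartedSpace H' M']

variable (I I') in
/-- The pullback `φ^* b` of a field of bilinear forms: `(φ^* b)_p(v, w) = b_{φ p}(dφ v, dφ w)`. -/
def pullbackForm (φ : M → M')
    (b : ∀ q : M', TangentSpace I' q →L[ℝ] TangentSpace I' q →L[ℝ] ℝ) (p : M) :
    TangentSpace I p →L[ℝ] TangentSpace I p →L[ℝ] ℝ :=
  (ContinuousLinearMap.precomp ℝ (mfderiv I I' φ p)).comp ((b (φ p)).comp (mfderiv I I' φ p))

theorem pullbackForm_apply (φ : M → M')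
    (b : ∀ q : M', TangentSpace I' q →L[ℝ] TangentSpace I' q →L[ℝ] ℝ) (p : M)
    (v w : TangentSpace I p) :
    pullbackForm I I' φ b p v w = b (φ p) (mfderiv I I' φ p v) (mfderiv I I' φ p w) := rfl

variable (I M) in
/-- A semi-Riemannian metric: a smooth field of nondegenerate symmetric bilinear forms on the
tangent spaces. (The index is then locally constant.) -/
structure SemiRiemannianMetric [IsManifold I ∞ M] where
  val : ∀ p : M, TangentSpace I p →L[ℝ] TangentSpace I p →L[ℝ] ℝ
  symm : ∀ (p : M) (v w : TangentSpace I p), val p v w = val p w v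
  nondegenerate : ∀ (p : M) (v : TangentSpace I p), (∀ w, val p v w = 0) → v = 0
  contMDiff : ContMDiff I (I.prod 𝓘(ℝ, E →L[ℝ] E →L[ℝ] ℝ)) ∞
    (fun p ↦ Bundle.TotalSpace.mk' (E →L[ℝ] E →L[ℝ] ℝ)
      (E := fun p : M ↦ TangentSpace I p →L[ℝ] TangentSpace I p →L[ℝ] ℝ) p (val p))

theorem contDiff_bilinearComp [FiniteDimensional ℝ E] : ContDiff ℝ ∞
    (fun p : (E' →L[ℝ] E' →L[ℝ] ℝ) × (E →L[ℝ] E') ↦ p.1.bilinearComp p.2 p.2) := by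
  rw [contDiff_clm_apply_iff]
  intro v
  rw [contDiff_clm_apply_iff]
  intro w
  simp only [ContinuousLinearMap.bilinearComp_apply]
  exact (contDiff_fst.clm_apply (contDiff_snd.clm_apply contDiff_const)).clm_apply
    (contDiff_snd.clm_apply contDiff_const)

/-- The pullback of a smooth field of bilinear forms by a smooth map is smooth. -/
theorem contMDiff_pullbackForm [FiniteDimensional ℝ E] [IsManifold I ∞ M] [IsManifold I' ∞ M'] {φ : M → M'}
    (hφ : ContMDiff I I' ∞ φ)
    {b : ∀ q : M', TangentSpace I' q →L[ℝ] TangentSpace I' q →L[ℝ] ℝ}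
    (hb : ContMDiff I' (I'.prod 𝓘(ℝ, E' →L[ℝ] E' →L[ℝ] ℝ)) ∞
      (fun q ↦ Bundle.TotalSpace.mk' (E' →L[ℝ] E' →L[ℝ] ℝ)
        (E := fun q : M' ↦ TangentSpace I' q →L[ℝ] TangentSpace I' q →L[ℝ] ℝ) q (b q))) :
    ContMDiff I (I.prod 𝓘(ℝ, E →L[ℝ] E →L[ℝ] ℝ)) ∞
      (fun p ↦ Bundle.TotalSpace.mk' (E →L[ℝ] E →L[ℝ] ℝ)
        (E := fun p : M ↦ TangentSpace I p →L[ℝ] TangentSpace I p →L[ℝ] ℝ) p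
        (pullbackForm I I' φ b p)) := by
  intro p₀
  rw [contMDiffAt_hom_bundle]
  refine ⟨contMDiffAt_id, ?_⟩
  have h1 := hb (φ p₀)
  rw [contMDiffAt_hom_bundle] at h1
  have h2 := h1.2.comp p₀ (hφ p₀)
  have h3 : ContMDiffAt I 𝓘(ℝ, E →L[ℝ] E') ∞ (inTangentCoordinates I I' id φ (mfderiv I I' φ) p₀)
    p₀ := (hφ p₀).mfderiv_const (m := ∞) (by simp)
  have h4 := (contDiff_bilinearComp (E := E) (E' := E')).contDiffAt.contMDiffAt.comp p₀
    (h2.prodMk_space h3)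
  refine h4.congr_of_eventuallyEq ?_
  have A : ∀ᶠ p in 𝓝 p₀, p ∈ (trivializationAt E (TangentSpace I) p₀).baseSet :=
    (trivializationAt E (TangentSpace I) p₀).open_baseSet.mem_nhds
      (FiberBundle.mem_baseSet_trivializationAt' p₀)
  have B : ∀ᶠ p in 𝓝 p₀, φ p ∈ (trivializationAt E' (TangentSpace I') (φ p₀)).baseSet :=
    (hφ p₀).continuousAt ((trivializationAt E' (TangentSpace I') (φ p₀)).open_baseSet.mem_nhds
      (FiberBundle.mem_baseSet_trivializationAt' (φ p₀)))
  filter_upwards [A, B] with p hp hp'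
  ext v w
  rw [inCoordinates_apply_eq₂ hp hp (Set.mem_univ _)]
  simp only [Function.comp_apply]
  rw [ContinuousLinearMap.bilinearComp_apply, inCoordinates_apply_eq₂ hp' hp' (Set.mem_univ _)]
  have key : ∀ v : E, (trivializationAt E' (TangentSpace I') (φ p₀)).symm (φ p)
      (inTangentCoordinates I I' id φ (mfderiv I I' φ) p₀ p v) =
      mfderiv I I' φ p ((trivializationAt E (TangentSpace I) p₀).symm p v) := by
    intro v
    have h5 : inTangentCoordinates I I' id φ (mfderiv I I' φ) p₀ p =
        ContinuousLinearMap.inCoordinates E (TangentSpace I) E' (TangentSpace I') p₀ p (φ p₀) (φ p)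
          (mfderiv I I' φ p) := rfl
    rw [h5, ContinuousLinearMap.inCoordinates_eq hp hp']
    simpa using (trivializationAt E' (TangentSpace I') (φ p₀)).symm_apply_apply_mk hp' _
  rw [key, key, pullbackForm_apply]
  simp

/-- The field of bilinear forms `π^* b + (f ∘ π)² σ^* c` on a product is smooth. -/
theorem contMDiff_warpedForm [FiniteDimensional ℝ E] [FiniteDimensional ℝ E']
    [IsManifold I ∞ M] [IsManifold I' ∞ M'] {f : M → ℝ} (hf : ContMDiff I 𝓘(ℝ) ∞ f)
    {b : ∀ q : M, TangentSpace I q →L[ℝ] TangentSpace I q →L[ℝ] ℝ}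
    (hb : ContMDiff I (I.prod 𝓘(ℝ, E →L[ℝ] E →L[ℝ] ℝ)) ∞
      (fun q ↦ Bundle.TotalSpace.mk' (E →L[ℝ] E →L[ℝ] ℝ)
        (E := fun q : M ↦ TangentSpace I q →L[ℝ] TangentSpace I q →L[ℝ] ℝ) q (b q)))
    {c : ∀ q : M', TangentSpace I' q →L[ℝ] TangentSpace I' q →L[ℝ] ℝ}
    (hc : ContMDiff I' (I'.prod 𝓘(ℝ, E' →L[ℝ] E' →L[ℝ] ℝ)) ∞
      (fun q ↦ Bundle.TotalSpace.mk' (E' →L[ℝ] E' →L[ℝ] ℝ)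
        (E := fun q : M' ↦ TangentSpace I' q →L[ℝ] TangentSpace I' q →L[ℝ] ℝ) q (c q))) :
    ContMDiff (I.prod I') ((I.prod I').prod 𝓘(ℝ, (E × E') →L[ℝ] (E × E') →L[ℝ] ℝ)) ∞
      (fun p ↦ Bundle.TotalSpace.mk' ((E × E') →L[ℝ] (E × E') →L[ℝ] ℝ)
        (E := fun p : M × M' ↦
          TangentSpace (I.prod I') p →L[ℝ] TangentSpace (I.prod I') p →L[ℝ] ℝ) p
        (pullbackForm (I.prod I') I Prod.fst b p +
          (f p.1) ^ 2 • pullbackForm (I.prod I') I' Prod.snd c p)) := by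
  have h1 := contMDiff_pullbackForm (contMDiff_fst (I := I) (J := I') (M := M) (N := M')) hb
  have h2 := contMDiff_pullbackForm (contMDiff_snd (I := I) (J := I') (M := M) (N := M')) hc
  have h3 : ContMDiff (I.prod I') 𝓘(ℝ) ∞ (fun p : M × M' ↦ (f p.1) ^ 2) :=
    (hf.comp contMDiff_fst).pow 2
  exact h1.add_section (h3.smul_section h2)

/-- The warped product metric `π^* g_B + (f ∘ π)² σ^* g_F` on `B × F` (here `M` is the base `B` and
`M'` is the fiber `F`), where `π`, `σ` are the projections and `f > 0` is a smooth function
on `B`. -/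
def warpedProduct [FiniteDimensional ℝ E] [FiniteDimensional ℝ E']
    [IsManifold I ∞ M] [IsManifold I' ∞ M']
    (gB : SemiRiemannianMetric I M) (f : M → ℝ) (hf : ContMDiff I 𝓘(ℝ) ∞ f) (hpos : ∀ x, 0 < f x)
    (gF : SemiRiemannianMetric I' M') : SemiRiemannianMetric (I.prod I') (M × M') where
  val p := pullbackForm (I.prod I') I Prod.fst gB.val p +
    (f p.1) ^ 2 • pullbackForm (I.prod I') I' Prod.snd gF.val p
  symm p v w := by
    simp only [add_apply, smul_apply, pullbackForm_apply]
    rw [gB.symm, gF.symm]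
  nondegenerate p v h := by
    have h' : ∀ w : TangentSpace (I.prod I') p,
        gB.val p.1 (v : E × E').1 (w : E × E').1 +
          (f p.1) ^ 2 * gF.val p.2 (v : E × E').2 (w : E × E').2 = 0 := by
      intro w
      have h1 := h w
      simp only [add_apply, smul_apply, pullbackForm_apply, mfderiv_fst, mfderiv_snd] at h1
      exact h1
    have hB0 : gB.val p.1 v.1 (0 : E) = 0 := map_zero (gB.val p.1 v.1)
    have hF0 : gF.val p.2 v.2 (0 : E') = 0 := map_zero (gF.val p.2 v.2)
    refine Prod.ext (gB.nondegenerate p.1 v.1 fun w ↦ ?_) (gF.nondegenerate p.2 v.2 fun w ↦ ?_)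
    · have h2 := h' (w, 0)
      rw [hF0, mul_zero, add_zero] at h2
      exact h2
    · have h2 : (f p.1) ^ 2 * gF.val p.2 v.2 w = 0 := by
        have h3 := h' (0, w)
        rw [hB0, zero_add] at h3
        exact h3
      exact (mul_eq_zero.mp h2).resolve_left (pow_ne_zero 2 (hpos p.1).ne')
  contMDiff := contMDiff_warpedForm hf gB.contMDiff gF.contMDiff

variable (I) in
/-- The differential `du` of a real-valued function. -/
def differential (u : M → ℝ) (p : M) : TangentSpace I p →L[ℝ] ℝ := mfderiv I 𝓘(ℝ) u p

namespace SemiRiemannianMetric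

variable [IsManifold I ∞ M] (g : SemiRiemannianMetric I M)

/-- The metric `g` read in the preferred chart `φ` at `p`, i.e. the pullback of `g` by `φ⁻¹`. -/
def inChart (p : M) (x : E) : E →L[ℝ] E →L[ℝ] ℝ :=
  pullbackForm 𝓘(ℝ, E) I (extChartAt I p).symm g.val x

/-- The gradient `∇u`: the vector field with `g(∇u, v) = du(v)`. -/
def grad (u : M → ℝ) (p : M) : TangentSpace I p :=
  (g.val p).inverse (differential I u p)

/-- The Hessian `(Hess u)_p = (∇du)_p`, computed in the preferred chart at `p`, in which
`TangentSpace I p` is identified with `E` by definition. -/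
def hessian (u : M → ℝ) (p : M) (v w : TangentSpace I p) : ℝ :=
  LocalGeometry.hessian (g.inChart p) (u ∘ (extChartAt I p).symm) (extChartAt I p p) v w

variable [FiniteDimensional ℝ E]

/-- The Ricci tensor at `p`, computed in the preferred chart at `p`, in which
`TangentSpace I p` is identified with `E` by definition. -/
def ricci (p : M) (v w : TangentSpace I p) : ℝ :=
  LocalGeometry.ricci (g.inChart p) (extChartAt I p p) v w

/-- The Laplacian `Δu = tr_g (Hess u)`. -/
def laplacian (u : M → ℝ) (p : M) : ℝ :=
  LocalGeometry.metricTrace (E := E) (g.val p) (g.hessian u p)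

/-- The drift Laplacian `Δ_w u = Δu - g(∇u, ∇w)`. -/
def driftLaplacian (w u : M → ℝ) (p : M) : ℝ :=
  g.laplacian u p - g.val p (g.grad u p) (g.grad w p)

/-- `(M, g)` together with the potential function `h`, the harmonic map `u : M → ℝ`, the coupling
constant `θ ≥ 0` and the constant `lam` is a gradient Ricci-harmonic soliton:
`Ric + Hess h - θ ∇u ⊗ ∇u = lam g` and `τ_g u - g(∇u, ∇h) = 0`. For real-valued `u` the tension
field `τ_g u = tr_g ∇du` is the Laplacian and `∇u ⊗ ∇u = du ⊗ du`. -/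
structure IsGRHS (h u : M → ℝ) (θ lam : ℝ) : Prop where
  theta_nonneg : 0 ≤ θ
  contMDiff_h : ContMDiff I 𝓘(ℝ) ∞ h
  contMDiff_u : ContMDiff I 𝓘(ℝ) ∞ u
  soliton_eq : ∀ (p : M) (v w : TangentSpace I p),
    g.ricci p v w + g.hessian h p v w
      - θ * (differential I u p v * differential I u p w) = lam * g.val p v w
  harmonic_eq : ∀ p : M, g.laplacian u p - g.val p (g.grad u p) (g.grad h p) = 0

/-- `(M, g)` is Einstein with `Ric = μ g`. -/
def IsEinstein (μ : ℝ) : Prop :=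
  ∀ (p : M) (v w : TangentSpace I p), g.ricci p v w = μ * g.val p v w

/-- `(M, g, u)` is harmonic-Einstein: `Ric - θ ∇u ⊗ ∇u = μ g` and `Δu = 0`. -/
def IsHarmonicEinstein (u : M → ℝ) (θ μ : ℝ) : Prop :=
  (∀ (p : M) (v w : TangentSpace I p),
    g.ricci p v w - θ * (differential I u p v * differential I u p w) = μ * g.val p v w) ∧
  ∀ p : M, g.laplacian u p = 0

end SemiRiemannianMetric

end Manifolds

end

/-! ### Linear algebra: nondegenerate forms and traces on a product -/

noncomputable section

/-! On a warped product, both `Ric` and the Hessian of a function pulled back from the base split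
into a tensor on `B` plus a scalar function on `B` times `g_F`, with `Ric_F` added in the Ricci
case; there are no mixed terms. Hence the tensor `Ric + Hess h - λ g` is a base tensor plus `Ric_F -
μ(b) g_F`, where `μ(b)` is exactly the scalar expression in `f`, `h_B` and `λ` of the statement. The
term `θ du ⊗ du` joins the base tensor in (a) and the fiber tensor in (b). Testing on horizontal and
vertical vectors separates the equation (`forall_add_eq_zero_iff_separated`). Since `m ≥ 1`, `g_F`
has a nonzero value, and comparing two base points over one fiber point shows that `μ` is constant;
connectedness plays no role.

The scalar equation follows from the Laplacians of pulled-back functions. From the base, `Δ(u_B ∘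
π)` gains `(m/f) du_B(∇f)`, which is the drift produced by `-m log f` in `ω`. From the fiber, `Δ(u_F
∘ σ) = f⁻² Δ_F u_F`, and the drift term vanishes because horizontal and vertical gradients are
orthogonal.

The splitting formulas are computed in a product chart. `christoffel_warped` checks the closed form
of the Christoffel symbols against the Koszul formula. Differentiating it gives the two diagonal
blocks of `v ↦ R(v, w) t`, which suffice for its trace (`ricci_warped`). `hessian_warped_fst` and
`hessian_warped_snd` come from the same symbols, and `inChart_warpedProduct` transports everything
to the manifold. -/

theorem ContinuousLinearMap.isInvertible_of_nondegenerate {E : Type*} [NormedAddCommGroup E]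
    [NormedSpace ℝ E] [FiniteDimensional ℝ E] {g : E →L[ℝ] E →L[ℝ] ℝ}
    (h : ∀ v, (∀ w, g v w = 0) → v = 0) : g.IsInvertible := by
  have hinj : Function.Injective (g : E →ₗ[ℝ] E →L[ℝ] ℝ) := by
    rw [injective_iff_map_eq_zero]
    intro v hv
    exact h v fun w ↦ by
      have := congrArg (fun L : E →L[ℝ] ℝ ↦ L w) hv
      simpa using this
  -- An injective map into the dual is bijective because the dimensions agree.
  have hdim : Module.finrank ℝ E = Module.finrank ℝ (E →L[ℝ] ℝ) := by
    rw [← (LinearMap.toContinuousLinearMap (𝕜 := ℝ) (E := E) (F' := ℝ)).finrank_eq]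
    exact (Subspace.dual_finrank_eq (K := ℝ) (V := E)).symm
  refine ⟨(LinearEquiv.ofInjectiveOfFinrankEq (g : E →ₗ[ℝ] E →L[ℝ] ℝ) hinj
    hdim).toContinuousLinearEquiv, ?_⟩
  ext v w
  rfl

theorem ContinuousLinearMap.IsInvertible.eq_zero_of_forall {E : Type*} [NormedAddCommGroup E]
    [NormedSpace ℝ E] {g : E →L[ℝ] E →L[ℝ] ℝ} (hg : g.IsInvertible) {v : E}
    (h : ∀ w, g v w = 0) : v = 0 :=
  hg.injective (by rw [map_zero]; ext w; simpa using h w)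

/-- Split `A` by the component of its value; cyclicity of the trace moves each inclusion to the
other end, leaving the two diagonal blocks. -/
theorem LinearMap.trace_prod_eq {E F : Type*} [AddCommGroup E] [Module ℝ E] [FiniteDimensional ℝ E]
    [AddCommGroup F] [Module ℝ F] [FiniteDimensional ℝ F] (A : (E × F) →ₗ[ℝ] (E × F)) :
    LinearMap.trace ℝ (E × F) A =
      LinearMap.trace ℝ E (LinearMap.fst ℝ E F ∘ₗ A ∘ₗ LinearMap.inl ℝ E F) +
      LinearMap.trace ℝ F (LinearMap.snd ℝ E F ∘ₗ A ∘ₗ LinearMap.inr ℝ E F) := by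
  have h : A = LinearMap.inl ℝ E F ∘ₗ (LinearMap.fst ℝ E F ∘ₗ A) +
      LinearMap.inr ℝ E F ∘ₗ (LinearMap.snd ℝ E F ∘ₗ A) := by
    ext x <;> simp
  conv_lhs => rw [h]
  rw [map_add, LinearMap.trace_comp_comm', LinearMap.trace_comp_comm' _ (LinearMap.inr ℝ E F)]
  rfl

/-! ### Levi-Civita calculus of a metric in one chart -/

namespace LocalGeometry

set_option synthInstance.maxHeartbeats 200000

variable {E : Type*} [NormedAddCommGroup E] [NormedSpace ℝ E]
  {F : Type*} [NormedAddCommGroup F] [NormedSpace ℝ F]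

/-- `G` is a field of symmetric bilinear forms, of class `C^2` and nondegenerate at `x`. -/
structure IsMetricAt (G : E → E →L[ℝ] E →L[ℝ] ℝ) (x : E) : Prop where
  contDiffAt : ContDiffAt ℝ 2 G x
  symm : ∀ y v w, G y v w = G y w v
  isInvertible : (G x).IsInvertible

instance : NormedAddCommGroup (E →L[ℝ] E →L[ℝ] ℝ) := ContinuousLinearMap.toNormedAddCommGroup

instance : NormedSpace ℝ (E →L[ℝ] E →L[ℝ] ℝ) := ContinuousLinearMap.toNormedSpace

variable {G : E → E →L[ℝ] E →L[ℝ] ℝ} {x : E}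

theorem IsMetricAt.differentiableAt (hG : IsMetricAt G x) : DifferentiableAt ℝ G x :=
  hG.contDiffAt.differentiableAt (by norm_num)

theorem fderiv_apply₁ (hG : DifferentiableAt ℝ G x) (v w : E) :
    fderiv ℝ (fun y ↦ G y w) x v = fderiv ℝ G x v w := by
  have h := hG.hasFDerivAt.clm_apply (hasFDerivAt_const w x)
  rw [h.fderiv]
  simp

theorem fderiv_apply₂ (hG : DifferentiableAt ℝ G x) (v w z : E) :
    fderiv ℝ (fun y ↦ G y w z) x v = fderiv ℝ G x v w z := by
  have h := (hG.hasFDerivAt.clm_apply (hasFDerivAt_const w x)).clm_apply (hasFDerivAt_const z x)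
  rw [h.fderiv]
  simp

/-- The covector `z ↦ ½ (D v w z + D w v z - D z v w)`. -/
def koszul (D : E →L[ℝ] E →L[ℝ] E →L[ℝ] ℝ) (v w : E) : E →L[ℝ] ℝ :=
  (1 / 2 : ℝ) • (D v w + D w v - (((ContinuousLinearMap.apply ℝ ℝ w).comp
    (ContinuousLinearMap.apply ℝ (E →L[ℝ] ℝ) v)).postcomp E D))

theorem koszul_apply (D : E →L[ℝ] E →L[ℝ] E →L[ℝ] ℝ) (v w z : E) :
    koszul D v w z = (1 / 2 : ℝ) * (D v w z + D w v z - D z v w) := rfl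

theorem koszul_add_left (D : E →L[ℝ] E →L[ℝ] E →L[ℝ] ℝ) (v v' w : E) :
    koszul D (v + v') w = koszul D v w + koszul D v' w := by
  ext z
  rw [add_apply]
  simp only [koszul_apply, map_add, add_apply]
  ring

theorem koszul_smul_left (D : E →L[ℝ] E →L[ℝ] E →L[ℝ] ℝ) (c : ℝ) (v w : E) :
    koszul D (c • v) w = c • koszul D v w := by
  ext z
  rw [smul_apply]
  simp only [koszul_apply, map_smul, smul_apply, smul_eq_mul]
  ring

theorem koszul_add_right (D : E →L[ℝ] E →L[ℝ] E →L[ℝ] ℝ) (v w w' : E) :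
    koszul D v (w + w') = koszul D v w + koszul D v w' := by
  ext z
  rw [add_apply]
  simp only [koszul_apply, map_add, add_apply]
  ring

theorem koszul_smul_right (D : E →L[ℝ] E →L[ℝ] E →L[ℝ] ℝ) (c : ℝ) (v w : E) :
    koszul D v (c • w) = c • koszul D v w := by
  ext z
  rw [smul_apply]
  simp only [koszul_apply, map_smul, smul_apply, smul_eq_mul]
  ring

theorem christoffel_eq (hG : DifferentiableAt ℝ G x) (v w : E) :
    christoffel G x v w = (G x).inverse (koszul (fderiv ℝ G x) v w) := by
  unfold christoffel
  congr 1
  ext z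
  rw [koszul_apply, fderiv_apply₁ hG, fderiv_apply₁ hG, ← fderiv_apply₂ hG z]
  rfl

/-- The Koszul formula. -/
theorem apply_christoffel (hG : DifferentiableAt ℝ G x) (hi : (G x).IsInvertible) (v w z : E) :
    G x (christoffel G x v w) z =
      (1 / 2 : ℝ) * (fderiv ℝ G x v w z + fderiv ℝ G x w v z - fderiv ℝ G x z v w) := by
  rw [christoffel_eq hG, hi.self_apply_inverse, koszul_apply]

/-- Nondegeneracy makes the Koszul formula characterise the symbol, so a guessed closed form only
has to be tested against all `z`. -/
theorem eq_christoffel (hG : DifferentiableAt ℝ G x) (hi : (G x).IsInvertible) {v w u : E}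
    (h : ∀ z, G x u z =
      (1 / 2 : ℝ) * (fderiv ℝ G x v w z + fderiv ℝ G x w v z - fderiv ℝ G x z v w)) :
    christoffel G x v w = u := by
  apply hi.injective
  ext z
  rw [apply_christoffel hG hi, h]

theorem christoffel_add_left (hG : DifferentiableAt ℝ G x) (v v' w : E) :
    christoffel G x (v + v') w = christoffel G x v w + christoffel G x v' w := by
  simp only [christoffel_eq hG, koszul_add_left, map_add]

theorem christoffel_smul_left (hG : DifferentiableAt ℝ G x) (c : ℝ) (v w : E) :
    christoffel G x (c • v) w = c • christoffel G x v w := by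
  simp only [christoffel_eq hG, koszul_smul_left, map_smul]

theorem christoffel_add_right (hG : DifferentiableAt ℝ G x) (v w w' : E) :
    christoffel G x v (w + w') = christoffel G x v w + christoffel G x v w' := by
  simp only [christoffel_eq hG, koszul_add_right, map_add]

theorem christoffel_smul_right (hG : DifferentiableAt ℝ G x) (c : ℝ) (v w : E) :
    christoffel G x v (c • w) = c • christoffel G x v w := by
  simp only [christoffel_eq hG, koszul_smul_right, map_smul]

theorem christoffel_zero_left (hG : DifferentiableAt ℝ G x) (w : E) : christoffel G x 0 w = 0 := by
  simpa using christoffel_smul_left hG 0 0 w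

theorem christoffel_zero_right (hG : DifferentiableAt ℝ G x) (v : E) :
    christoffel G x v 0 = 0 := by
  simpa using christoffel_smul_right hG 0 v 0

theorem fderiv_symm (hG : DifferentiableAt ℝ G x) (hs : ∀ y v w, G y v w = G y w v) (u v w : E) :
    fderiv ℝ G x u v w = fderiv ℝ G x u w v := by
  rw [← fderiv_apply₂ hG, ← fderiv_apply₂ hG]
  simp only [hs _ v w]

theorem christoffel_symm (hs : ∀ y v w, G y v w = G y w v) (v w : E) :
    christoffel G x v w = christoffel G x w v := by
  unfold christoffel
  simp only [hs _ v w]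
  rw [add_comm (fderiv ℝ (fun y ↦ G y w) x v)]

theorem differentiableAt_fderiv_of_contDiffAt {V : Type*} [NormedAddCommGroup V]
    [NormedSpace ℝ V] {D : E → V} (hD : ContDiffAt ℝ 2 D x) : DifferentiableAt ℝ (fderiv ℝ D) x :=
  (hD.fderiv_right (m := 1) (by norm_num)).differentiableAt (by norm_num)

theorem differentiableAt_postcomp {V W : Type*} [NormedAddCommGroup V] [NormedSpace ℝ V]
    [NormedAddCommGroup W] [NormedSpace ℝ W] (L : V →L[ℝ] W) {D : E → E →L[ℝ] V}
    (hD : DifferentiableAt ℝ D x) : DifferentiableAt ℝ (fun y ↦ L.postcomp E (D y)) x :=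
  (L.postcomp E).differentiableAt.comp x hD

/-- Invertibility is an open condition. Identities for Christoffel symbols thus hold near `x` and
may be differentiated there, as the curvature requires. -/
theorem IsMetricAt.eventually [CompleteSpace E] (hG : IsMetricAt G x) :
    ∀ᶠ y in 𝓝 x, IsMetricAt G y := by
  obtain ⟨e, he⟩ := hG.isInvertible
  have h1 : ∀ᶠ y in 𝓝 x, (G y).IsInvertible := by
    have h := ContinuousLinearEquiv.nhds e
    rw [he] at h
    exact hG.contDiffAt.continuousAt h
  filter_upwards [h1, hG.contDiffAt.eventually (by simp)] with y hy hy'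
  exact ⟨hy', hG.symm, hy⟩

theorem IsMetricAt.differentiableAt_fderiv (hG : IsMetricAt G x) :
    DifferentiableAt ℝ (fderiv ℝ G) x :=
  differentiableAt_fderiv_of_contDiffAt hG.contDiffAt

theorem IsMetricAt.differentiableAt_inverse [CompleteSpace E] (hG : IsMetricAt G x) :
    DifferentiableAt ℝ (fun y ↦ (G y).inverse) x :=
  ((hG.isInvertible.contDiffAt_map_inverse (n := 2)).comp x hG.contDiffAt).differentiableAt
    (by norm_num)

theorem IsMetricAt.differentiableAt_christoffel [CompleteSpace E] (hG : IsMetricAt G x) (v w : E) :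
    DifferentiableAt ℝ (fun y ↦ christoffel G y v w) x := by
  have h : (fun y ↦ christoffel G y v w) =ᶠ[𝓝 x] fun y ↦
      (G y).inverse (koszul (fderiv ℝ G y) v w) := by
    filter_upwards [hG.eventually] with y hy
    exact christoffel_eq hy.differentiableAt v w
  rw [h.differentiableAt_iff]
  have hd := hG.differentiableAt_fderiv
  refine hG.differentiableAt_inverse.clm_apply (DifferentiableAt.fun_const_smul
    (DifferentiableAt.fun_sub (DifferentiableAt.fun_add ?_ ?_) ?_) _)
  · exact (hd.clm_apply (differentiableAt_const v)).clm_apply (differentiableAt_const w)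
  · exact (hd.clm_apply (differentiableAt_const w)).clm_apply (differentiableAt_const v)
  · exact differentiableAt_postcomp (V := E →L[ℝ] E →L[ℝ] ℝ) (W := ℝ)
      ((ContinuousLinearMap.apply ℝ ℝ w).comp (ContinuousLinearMap.apply ℝ (E →L[ℝ] ℝ) v)) hd

section Curvature

variable [CompleteSpace E]

theorem curvature_add (hG : IsMetricAt G x) (v v' w z : E) :
    curvature G x (v + v') w z = curvature G x v w z + curvature G x v' w z := by
  have h : (fun y ↦ christoffel G y (v + v') z) =ᶠ[𝓝 x] fun y ↦
      christoffel G y v z + christoffel G y v' z := by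
    filter_upwards [hG.eventually] with y hy
    exact christoffel_add_left hy.differentiableAt _ _ _
  have hd := hG.differentiableAt
  unfold curvature
  rw [h.fderiv_eq, fderiv_fun_add (hG.differentiableAt_christoffel _ _)
    (hG.differentiableAt_christoffel _ _)]
  simp only [christoffel_add_left hd, christoffel_add_right hd, map_add, add_apply]
  abel

theorem curvature_smul (hG : IsMetricAt G x) (c : ℝ) (v w z : E) :
    curvature G x (c • v) w z = c • curvature G x v w z := by
  have h : (fun y ↦ christoffel G y (c • v) z) =ᶠ[𝓝 x] fun y ↦ c • christoffel G y v z := by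
    filter_upwards [hG.eventually] with y hy
    exact christoffel_smul_left hy.differentiableAt _ _ _
  have hd := hG.differentiableAt
  unfold curvature
  rw [h.fderiv_eq, fderiv_fun_const_smul (hG.differentiableAt_christoffel _ _)]
  simp only [christoffel_smul_left hd, christoffel_smul_right hd, map_smul, smul_apply,
    smul_add, smul_sub]

/-- The linear map `v ↦ R(v, w) z`, whose trace is the Ricci tensor. -/
def curvatureLinear (hG : IsMetricAt G x) (w z : E) : E →ₗ[ℝ] E where
  toFun v := curvature G x v w z
  map_add' v v' := curvature_add hG v v' w z
  map_smul' c v := curvature_smul hG c v w z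

@[simp] theorem curvatureLinear_apply (hG : IsMetricAt G x) (v w z : E) :
    curvatureLinear hG w z v = curvature G x v w z := rfl

end Curvature

theorem ricci_eq_trace [FiniteDimensional ℝ E] [CompleteSpace E] (hG : IsMetricAt G x) (w z : E) :
    ricci G x w z = LinearMap.trace ℝ E (curvatureLinear hG w z) := by
  rw [LinearMap.trace_eq_matrix_trace ℝ (Module.finBasis ℝ E)]
  simp [ricci, Matrix.trace, LinearMap.toMatrix_apply]

/-- Raising an index of `T` gives the endomorphism `A`, whose trace needs no basis. All later traces
are computed through such an `A`. -/
theorem metricTrace_eq_trace [FiniteDimensional ℝ E] {g : E →L[ℝ] E →L[ℝ] ℝ}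
    {T : E → E → ℝ} {A : E →ₗ[ℝ] E} (hs : ∀ v w, g v w = g w v) (hi : g.IsInvertible)
    (hA : ∀ v w, g (A v) w = T v w) : metricTrace g T = LinearMap.trace ℝ E A := by
  set b := Module.finBasis ℝ E
  have key : ∀ L : E →L[ℝ] ℝ, ∑ j, b.coord j
      (g.inverse L) • b j = g.inverse L := fun L ↦ b.sum_repr _
  -- The inverse matrix `g^{ij}` inherits symmetry from `g`.
  have hsymm : ∀ i j, b.coord i (g.inverse (LinearMap.toContinuousLinearMap (b.coord j))) =
      b.coord j (g.inverse (LinearMap.toContinuousLinearMap (b.coord i))) := by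
    have h : ∀ (L L' : E →L[ℝ] ℝ), L (g.inverse L') = L' (g.inverse L) := fun L L' ↦ by
      conv_lhs => rw [← hi.self_apply_inverse L]
      conv_rhs => rw [← hi.self_apply_inverse L']
      exact hs _ _
    exact fun i j ↦ h (LinearMap.toContinuousLinearMap (b.coord i))
      (LinearMap.toContinuousLinearMap (b.coord j))
  rw [LinearMap.trace_eq_matrix_trace ℝ b]
  simp only [metricTrace, Matrix.trace, LinearMap.toMatrix_apply, Matrix.diag_apply]
  refine Finset.sum_congr rfl fun i _ ↦ ?_
  have h1 : ∀ j, T (b i) (b j) = g (A (b i)) (b j) := fun j ↦ (hA _ _).symm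
  calc ∑ j, b.coord i (g.inverse (LinearMap.toContinuousLinearMap (b.coord j))) * T (b i) (b j)
      = g (A (b i)) (∑ j, b.coord j
          (g.inverse (LinearMap.toContinuousLinearMap (b.coord i))) • b j) := by
        rw [map_sum]
        refine Finset.sum_congr rfl fun j _ ↦ ?_
        rw [hsymm, h1, map_smul, smul_eq_mul]
    _ = b.repr (A (b i)) i := by
        rw [key, hs, hi.self_apply_inverse]
        rfl

theorem metricTrace_const_mul_self [FiniteDimensional ℝ E] {g : E →L[ℝ] E →L[ℝ] ℝ}
    (hs : ∀ v w, g v w = g w v) (hi : g.IsInvertible) (c : ℝ) :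
    metricTrace g (fun v w ↦ c * g v w) = c * Module.finrank ℝ E := by
  rw [metricTrace_eq_trace (A := c • LinearMap.id) hs hi (by simp)]
  simp

theorem ricci_zero_left [FiniteDimensional ℝ E] (hG : IsMetricAt G x) (z : E) :
    ricci G x 0 z = 0 := by
  have h : (fun y ↦ christoffel G y 0 z) =ᶠ[𝓝 x] fun _ ↦ 0 := by
    filter_upwards [hG.eventually] with y hy
    exact christoffel_zero_left hy.differentiableAt z
  simp [ricci, curvature, h.fderiv_eq, christoffel_zero_left hG.differentiableAt,
    christoffel_zero_right hG.differentiableAt]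

theorem hessian_zero_left (hG : IsMetricAt G x) (φ : E → ℝ) (w : E) : hessian G φ x 0 w = 0 := by
  simp [hessian, christoffel_zero_left hG.differentiableAt]

/-- The gradient of `φ` with respect to `G`. -/
def gradient (G : E → E →L[ℝ] E →L[ℝ] ℝ) (φ : E → ℝ) (x : E) : E :=
  (G x).inverse (fderiv ℝ φ x)

variable {φ : E → ℝ}

theorem apply_gradient (hi : (G x).IsInvertible) (w : E) :
    G x (gradient G φ x) w = fderiv ℝ φ x w := by
  rw [gradient, hi.self_apply_inverse]

theorem IsMetricAt.differentiableAt_gradient [CompleteSpace E] (hG : IsMetricAt G x)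
    (hφ : ContDiffAt ℝ 2 φ x) : DifferentiableAt ℝ (gradient G φ) x :=
  hG.differentiableAt_inverse.clm_apply
    (differentiableAt_fderiv_of_contDiffAt hφ)

theorem hessian_eq (hφ : ContDiffAt ℝ 2 φ x) (v w : E) :
    hessian G φ x v w =
      fderiv ℝ (fderiv ℝ φ) x v w - fderiv ℝ φ x (christoffel G x v w) := by
  have hd : DifferentiableAt ℝ (fderiv ℝ φ) x :=
    differentiableAt_fderiv_of_contDiffAt hφ
  unfold hessian
  rw [(hd.hasFDerivAt.clm_apply (hasFDerivAt_const w x)).fderiv]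
  simp

/-- The covariant derivative `v ↦ ∇_v (∇φ)` of the gradient. -/
def covGradient [CompleteSpace E] (hG : IsMetricAt G x) (φ : E → ℝ) : E →ₗ[ℝ] E where
  toFun v := fderiv ℝ (gradient G φ) x v + christoffel G x v (gradient G φ x)
  map_add' v v' := by
    rw [map_add, christoffel_add_left hG.differentiableAt]
    abel
  map_smul' c v := by
    rw [map_smul, christoffel_smul_left hG.differentiableAt, smul_add]
    rfl

/-- Differentiate `G(∇φ, w) = dφ(w)`. The derivative of `G` is absorbed by the two Koszul
expressions, whose sum is metric compatibility. -/
theorem apply_covGradient [CompleteSpace E] (hG : IsMetricAt G x)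
    (hφ : ContDiffAt ℝ 2 φ x) (v w : E) :
    G x (covGradient hG φ v) w = hessian G φ x v w := by
  have hd := hG.differentiableAt
  have hN := hG.differentiableAt_gradient hφ
  have h1 : (fun y ↦ G y (gradient G φ y)) =ᶠ[𝓝 x] fderiv ℝ φ := by
    filter_upwards [hG.eventually] with y hy
    ext w
    exact apply_gradient hy.isInvertible w
  have h2 := (hd.hasFDerivAt.clm_apply hN.hasFDerivAt).fderiv
  rw [h1.fderiv_eq] at h2
  have h3 : fderiv ℝ φ x (christoffel G x v w) =
      G x (christoffel G x v w) (gradient G φ x) := by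
    rw [hG.symm, apply_gradient hG.isInvertible]
  rw [hessian_eq hφ, h2, h3, apply_christoffel hd hG.isInvertible]
  simp only [covGradient, LinearMap.coe_mk, AddHom.coe_mk, map_add, add_apply]
  rw [apply_christoffel hd hG.isInvertible]
  simp
  rw [fderiv_symm hd hG.symm v w]
  ring

theorem metricTrace_hessian [FiniteDimensional ℝ E] [CompleteSpace E] (hG : IsMetricAt G x)
    (hφ : ContDiffAt ℝ 2 φ x) :
    metricTrace (G x) (hessian G φ x) = LinearMap.trace ℝ E (covGradient hG φ) :=
  metricTrace_eq_trace (hG.symm x) hG.isInvertible (apply_covGradient hG hφ)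

end LocalGeometry

/-! ### Locality, and warped metrics on a product of vector spaces -/

namespace LocalGeometry

set_option synthInstance.maxHeartbeats 200000

variable {E : Type*} [NormedAddCommGroup E] [NormedSpace ℝ E]
  {F : Type*} [NormedAddCommGroup F] [NormedSpace ℝ F]

section Congruence

variable {G G' : E → E →L[ℝ] E →L[ℝ] ℝ} {φ φ' : E → ℝ} {x : E}

theorem christoffel_congr (h : G =ᶠ[𝓝 x] G') (v w : E) :
    christoffel G x v w = christoffel G' x v w := by
  have h1 : ∀ w, (fun y ↦ G y w) =ᶠ[𝓝 x] fun y ↦ G' y w := fun w ↦ h.fun_comp (fun L ↦ L w)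
  have h2 : ∀ v w, (fun y ↦ G y v w) =ᶠ[𝓝 x] fun y ↦ G' y v w :=
    fun v w ↦ h.fun_comp (fun L ↦ L v w)
  unfold christoffel
  rw [(h1 v).fderiv_eq, (h1 w).fderiv_eq, (h2 v w).fderiv_eq, h.self_of_nhds]

theorem curvature_congr (h : G =ᶠ[𝓝 x] G') (v w z : E) :
    curvature G x v w z = curvature G' x v w z := by
  have h1 : ∀ v w, (fun y ↦ christoffel G y v w) =ᶠ[𝓝 x] fun y ↦ christoffel G' y v w := by
    intro v w
    filter_upwards [h.eventuallyEq_nhds] with y hy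
    exact christoffel_congr hy v w
  unfold curvature
  rw [(h1 w z).fderiv_eq, (h1 v z).fderiv_eq]
  simp only [christoffel_congr h]

/-- Curvature sees only the germ of the metric. This matters because the chart expression of a
warped product is identified only near the base point. -/
theorem ricci_congr [FiniteDimensional ℝ E] (h : G =ᶠ[𝓝 x] G') (w z : E) :
    ricci G x w z = ricci G' x w z := by
  simp only [ricci, curvature_congr h]

theorem hessian_congr (h : G =ᶠ[𝓝 x] G') (hφ : φ =ᶠ[𝓝 x] φ') (v w : E) :
    hessian G φ x v w = hessian G' φ' x v w := by
  have h1 : (fun y ↦ fderiv ℝ φ y w) =ᶠ[𝓝 x] fun y ↦ fderiv ℝ φ' y w := by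
    filter_upwards [hφ.eventuallyEq_nhds] with y hy
    rw [hy.fderiv_eq]
  unfold hessian
  rw [h1.fderiv_eq, hφ.fderiv_eq, christoffel_congr h]

end Congruence

/-- The bilinear form `g + c² k` on `E × F`. -/
def warpedForm (g : E →L[ℝ] E →L[ℝ] ℝ) (c : ℝ) (k : F →L[ℝ] F →L[ℝ] ℝ) :
    (E × F) →L[ℝ] (E × F) →L[ℝ] ℝ :=
  g.bilinearComp (.fst ℝ E F) (.fst ℝ E F) + c ^ 2 • k.bilinearComp (.snd ℝ E F) (.snd ℝ E F)

@[simp] theorem warpedForm_apply (g : E →L[ℝ] E →L[ℝ] ℝ) (c : ℝ) (k : F →L[ℝ] F →L[ℝ] ℝ)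
    (v w : E × F) : warpedForm g c k v w = g v.1 w.1 + c ^ 2 * k v.2 w.2 := rfl

theorem warpedForm_isInvertible [FiniteDimensional ℝ E] [FiniteDimensional ℝ F]
    {g : E →L[ℝ] E →L[ℝ] ℝ} {c : ℝ} {k : F →L[ℝ] F →L[ℝ] ℝ} (hg : g.IsInvertible) (hc : c ≠ 0)
    (hk : k.IsInvertible) : (warpedForm g c k).IsInvertible := by
  refine ContinuousLinearMap.isInvertible_of_nondegenerate fun v h ↦ ?_
  refine Prod.ext (hg.eq_zero_of_forall fun w ↦ ?_) (hk.eq_zero_of_forall fun w ↦ ?_)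
  · simpa using h (w, 0)
  · simpa [hc] using h (0, w)

/-- The trace with respect to `g + c² k` is the sum of the traces on the two factors. -/
theorem metricTrace_warpedForm [FiniteDimensional ℝ E] [FiniteDimensional ℝ F]
    {g : E →L[ℝ] E →L[ℝ] ℝ} {c : ℝ} {k : F →L[ℝ] F →L[ℝ] ℝ} (hg : g.IsInvertible) (hc : c ≠ 0)
    (hk : k.IsInvertible) (hgs : ∀ v w, g v w = g w v) (hks : ∀ v w, k v w = k w v)
    {T : E × F → E × F → ℝ} {A : (E × F) →ₗ[ℝ] (E × F)}
    (hA : ∀ v w, warpedForm g c k (A v) w = T v w) :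
    metricTrace (warpedForm g c k) T = metricTrace g (fun v w ↦ T (v, 0) (w, 0)) +
      (c ^ 2)⁻¹ * metricTrace k (fun v w ↦ T (0, v) (0, w)) := by
  have hi := warpedForm_isInvertible hg hc hk
  rw [metricTrace_eq_trace (fun v w ↦ by simp [hgs v.1, hks v.2]) hi hA, LinearMap.trace_prod_eq]
  congr 1
  · refine (metricTrace_eq_trace hgs hg fun v w ↦ ?_).symm
    simpa using hA (v, 0) (w, 0)
  · have h : metricTrace k (fun v w ↦ T (0, v) (0, w)) = LinearMap.trace ℝ F
        (c ^ 2 • (LinearMap.snd ℝ E F ∘ₗ A ∘ₗ LinearMap.inr ℝ E F)) := by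
      refine metricTrace_eq_trace hks hk fun v w ↦ ?_
      simpa using hA (0, v) (0, w)
    rw [h, map_smul, smul_eq_mul, inv_mul_cancel_left₀ (pow_ne_zero 2 hc)]

variable {G : E → E →L[ℝ] E →L[ℝ] ℝ} {φ : E → ℝ} {K : F → F →L[ℝ] F →L[ℝ] ℝ} {z : E × F}

/-- The metric `G + φ² K` on `E × F`. -/
def warped (G : E → E →L[ℝ] E →L[ℝ] ℝ) (φ : E → ℝ) (K : F → F →L[ℝ] F →L[ℝ] ℝ) (z : E × F) :
    (E × F) →L[ℝ] (E × F) →L[ℝ] ℝ :=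
  warpedForm (G z.1) (φ z.1) (K z.2)

@[simp] theorem warped_apply (z v w : E × F) :
    warped G φ K z v w = G z.1 v.1 w.1 + φ z.1 ^ 2 * K z.2 v.2 w.2 := rfl

theorem contDiffAt_bilinearComp_const {V W X : Type*} [NormedAddCommGroup V] [NormedSpace ℝ V]
    [NormedAddCommGroup W] [NormedSpace ℝ W] [FiniteDimensional ℝ W] [NormedAddCommGroup X]
    [NormedSpace ℝ X] {b : X → V →L[ℝ] V →L[ℝ] ℝ} {p : X} (hb : ContDiffAt ℝ 2 b p)
    (L : W →L[ℝ] V) : ContDiffAt ℝ 2 (fun q ↦ (b q).bilinearComp L L) p := by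
  have h : (fun q ↦ (b q).bilinearComp L L) =
      fun q ↦ (ContinuousLinearMap.precomp ℝ L).comp ((b q).comp L) := rfl
  rw [h]
  exact contDiffAt_const.clm_comp (hb.clm_comp contDiffAt_const)

theorem IsMetricAt.warped [FiniteDimensional ℝ E] [FiniteDimensional ℝ F]
    (hG : IsMetricAt G z.1) (hφ : ContDiffAt ℝ 2 φ z.1) (h0 : φ z.1 ≠ 0)
    (hK : IsMetricAt K z.2) : IsMetricAt (warped G φ K) z where
  contDiffAt :=
    (contDiffAt_bilinearComp_const (hG.contDiffAt.comp z contDiffAt_fst) _).add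
      (((hφ.comp z contDiffAt_fst).pow 2).smul
        (contDiffAt_bilinearComp_const (hK.contDiffAt.comp z contDiffAt_snd) _))
  symm y v w := by simp [hG.symm y.1 v.1, hK.symm y.2 v.2]
  isInvertible := warpedForm_isInvertible hG.isInvertible h0 hK.isInvertible

theorem fderiv_warped [FiniteDimensional ℝ E] [FiniteDimensional ℝ F]
    (hG : IsMetricAt G z.1) (hφ : ContDiffAt ℝ 2 φ z.1) (h0 : φ z.1 ≠ 0)
    (hK : IsMetricAt K z.2) (u v w : E × F) :
    fderiv ℝ (warped G φ K) z u v w = fderiv ℝ G z.1 u.1 v.1 w.1 +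
      2 * φ z.1 * fderiv ℝ φ z.1 u.1 * K z.2 v.2 w.2 +
        φ z.1 ^ 2 * fderiv ℝ K z.2 u.2 v.2 w.2 := by
  have h1 : HasFDerivAt (fun y ↦ G y v.1 w.1) _ z.1 :=
    (hG.differentiableAt.hasFDerivAt.clm_apply (hasFDerivAt_const v.1 z.1)).clm_apply
      (hasFDerivAt_const w.1 z.1)
  have h2 : HasFDerivAt (fun y ↦ K y v.2 w.2) _ z.2 :=
    (hK.differentiableAt.hasFDerivAt.clm_apply (hasFDerivAt_const v.2 z.2)).clm_apply
      (hasFDerivAt_const w.2 z.2)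
  have h3 := (hφ.differentiableAt (by norm_num)).hasFDerivAt
  have h4 := (h1.comp z hasFDerivAt_fst).add
    (((h3.comp z hasFDerivAt_fst).pow 2).mul (h2.comp z hasFDerivAt_snd))
  rw [← fderiv_apply₂ (hG.warped hφ h0 hK).differentiableAt, show
    (fun y ↦ LocalGeometry.warped G φ K y v w) = _ from rfl]
  refine (congrArg (fun L : (E × F) →L[ℝ] ℝ ↦ L u) h4.fderiv).trans ?_
  simp
  ring

/-- The derivative of `φ²` is the only coupling between the factors. Along fiber directions it
produces the normal term `-φ K ∇φ`, and in mixed directions the factor `dφ/φ`. -/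
theorem christoffel_warped [FiniteDimensional ℝ E] [FiniteDimensional ℝ F]
    (hG : IsMetricAt G z.1) (hφ : ContDiffAt ℝ 2 φ z.1) (h0 : φ z.1 ≠ 0)
    (hK : IsMetricAt K z.2) (v w : E × F) :
    christoffel (warped G φ K) z v w =
      (christoffel G z.1 v.1 w.1 + (-(φ z.1 * K z.2 v.2 w.2)) • gradient G φ z.1,
        christoffel K z.2 v.2 w.2 + ((φ z.1)⁻¹ * fderiv ℝ φ z.1 v.1) • w.2 +
          ((φ z.1)⁻¹ * fderiv ℝ φ z.1 w.1) • v.2) := by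
  have hW := hG.warped hφ h0 hK
  refine eq_christoffel hW.differentiableAt hW.isInvertible fun ζ ↦ ?_
  simp only [warped_apply, map_add, map_smul, add_apply, smul_apply, smul_eq_mul,
    apply_christoffel hG.differentiableAt hG.isInvertible,
    apply_christoffel hK.differentiableAt hK.isInvertible, apply_gradient hG.isInvertible,
    fderiv_warped hG hφ h0 hK]
  field_simp
  ring


section Ricci

variable [FiniteDimensional ℝ E] [FiniteDimensional ℝ F]

theorem fderiv_christoffel_warped (hG : IsMetricAt G z.1) (hφ : ContDiffAt ℝ 2 φ z.1)
    (h0 : φ z.1 ≠ 0) (hK : IsMetricAt K z.2) (u v w : E × F) :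
    fderiv ℝ (fun y ↦ christoffel (warped G φ K) y v w) z u =
      (fderiv ℝ (fun x ↦ christoffel G x v.1 w.1) z.1 u.1 +
          ((-(φ z.1 * K z.2 v.2 w.2)) • fderiv ℝ (gradient G φ) z.1 u.1 +
          (-(fderiv ℝ φ z.1 u.1 * K z.2 v.2 w.2 + φ z.1 * fderiv ℝ K z.2 u.2 v.2 w.2)) •
            gradient G φ z.1),
        fderiv ℝ (fun x ↦ christoffel K x v.2 w.2) z.2 u.2 +
          ((φ z.1)⁻¹ * fderiv ℝ (fderiv ℝ φ) z.1 u.1 v.1 -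
            (φ z.1)⁻¹ ^ 2 * fderiv ℝ φ z.1 u.1 * fderiv ℝ φ z.1 v.1) • w.2 +
          ((φ z.1)⁻¹ * fderiv ℝ (fderiv ℝ φ) z.1 u.1 w.1 -
            (φ z.1)⁻¹ ^ 2 * fderiv ℝ φ z.1 u.1 * fderiv ℝ φ z.1 w.1) • v.2) := by
  have hev : (fun y ↦ christoffel (warped G φ K) y v w) =ᶠ[𝓝 z] fun z ↦
      (christoffel G z.1 v.1 w.1 + (-(φ z.1 * K z.2 v.2 w.2)) • gradient G φ z.1,
        christoffel K z.2 v.2 w.2 + ((φ z.1)⁻¹ * fderiv ℝ φ z.1 v.1) • w.2 +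
          ((φ z.1)⁻¹ * fderiv ℝ φ z.1 w.1) • v.2) := by
    -- All hypotheses of the closed formula, including `φ ≠ 0`, are open conditions.
    filter_upwards [continuousAt_fst.eventually hG.eventually,
      continuousAt_snd.eventually hK.eventually,
      continuousAt_fst.eventually (hφ.eventually (by simp)),
      continuousAt_fst.eventually (hφ.continuousAt.eventually_ne h0)] with y h1 h2 h3 h4
    exact christoffel_warped h1 h3 h4 h2 v w
  have dΓG := ((hG.differentiableAt_christoffel v.1 w.1).hasFDerivAt).comp z hasFDerivAt_fst
  have dΓK := ((hK.differentiableAt_christoffel v.2 w.2).hasFDerivAt).comp z hasFDerivAt_snd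
  have dK : HasFDerivAt (fun y ↦ K y v.2 w.2) _ z.2 :=
    (hK.differentiableAt.hasFDerivAt.clm_apply (hasFDerivAt_const v.2 z.2)).clm_apply
      (hasFDerivAt_const w.2 z.2)
  have dK' := dK.comp z hasFDerivAt_snd
  have dφ := (hφ.differentiableAt (by norm_num)).hasFDerivAt.comp z hasFDerivAt_fst
  have dN := (hG.differentiableAt_gradient hφ).hasFDerivAt.comp z hasFDerivAt_fst
  have dD := (differentiableAt_fderiv_of_contDiffAt hφ).hasFDerivAt.comp z hasFDerivAt_fst
  have da : ∀ e : E, HasFDerivAt (fun y : E × F ↦ (φ y.1)⁻¹ * fderiv ℝ φ y.1 e) _ z := fun e ↦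
    ((hasDerivAt_inv h0).comp_hasFDerivAt z dφ).mul (dD.clm_apply (hasFDerivAt_const e z))
  have h := (dΓG.add ((dφ.mul dK').neg.smul dN)).prodMk
    ((dΓK.add ((da v.1).smul_const w.2)).add ((da w.1).smul_const v.2))
  rw [hev.fderiv_eq]
  refine (congrArg (fun L : (E × F) →L[ℝ] (E × F) ↦ L u) h.fderiv).trans ?_
  ext1
  · simp
    module
  · simp
    module

/-- Horizontal block of the curvature endomorphism. The terms `dφ(v) K ∇φ` cancel, and what is left
of the derivative of `φ K ∇φ` is the covariant derivative of the gradient. -/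
theorem curvature_warped_fst (hG : IsMetricAt G z.1) (hφ : ContDiffAt ℝ 2 φ z.1)
    (h0 : φ z.1 ≠ 0) (hK : IsMetricAt K z.2) (v : E) (w t : E × F) :
    (curvature (warped G φ K) z (v, 0) w t).1 =
      curvature G z.1 v w.1 t.1 - (φ z.1 * K z.2 w.2 t.2) • covGradient hG φ v := by
  unfold curvature
  simp only [fderiv_christoffel_warped hG hφ h0 hK, christoffel_warped hG hφ h0 hK,
    christoffel_add_right hG.differentiableAt, christoffel_smul_right hG.differentiableAt,
    covGradient, LinearMap.coe_mk, AddHom.coe_mk, Prod.fst_add, Prod.fst_sub, map_zero, zero_apply,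
    map_add, map_smul, smul_eq_mul, smul_zero, add_zero, mul_zero, neg_zero, zero_smul, zero_add,
    christoffel_zero_left hK.differentiableAt]
  match_scalars <;> field_simp
  ring

/-- Vertical block. The products `φ⁻² dφ dφ` cancel, so the second derivative of `φ` and its
Christoffel correction form the Hessian; the `K` terms arise from feeding `-φ K ∇φ` back into the
mixed symbol. -/
theorem curvature_warped_snd (hG : IsMetricAt G z.1) (hφ : ContDiffAt ℝ 2 φ z.1)
    (h0 : φ z.1 ≠ 0) (hK : IsMetricAt K z.2) (v : F) (w t : E × F) :
    (curvature (warped G φ K) z (0, v) w t).2 =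
      curvature K z.2 v w.2 t.2 - ((φ z.1)⁻¹ * hessian G φ z.1 w.1 t.1) • v
        - (fderiv ℝ φ z.1 (gradient G φ z.1) * K z.2 w.2 t.2) • v
        + (fderiv ℝ φ z.1 (gradient G φ z.1) * K z.2 v t.2) • w.2 := by
  unfold curvature
  rw [hessian_eq hφ]
  simp only [fderiv_christoffel_warped hG hφ h0 hK, christoffel_warped hG hφ h0 hK,
    christoffel_add_right hK.differentiableAt, christoffel_smul_right hK.differentiableAt,
    Prod.snd_add, Prod.snd_sub, map_zero, zero_apply,
    map_add, map_smul, smul_eq_mul, smul_zero, add_zero, mul_zero, zero_smul, zero_add,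
    christoffel_zero_left hG.differentiableAt]
  -- Torsion-freeness lets the two terms `φ⁻¹ dφ(t.1) Γ(v, w.2)` cancel.
  rw [christoffel_symm hK.symm w.2 v]
  match_scalars <;> field_simp <;> ring

/-- Take traces of the two blocks. The identity on `F` contributes its dimension, and the rank-one
term in the vertical block gives back one copy of `|∇φ|² K`, whence the factor `dim F - 1`. The
horizontal block contributes `φ Δφ`. -/
theorem ricci_warped (hG : IsMetricAt G z.1) (hφ : ContDiffAt ℝ 2 φ z.1)
    (h0 : φ z.1 ≠ 0) (hK : IsMetricAt K z.2) (v w : E × F) :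
    ricci (warped G φ K) z v w =
      ricci G z.1 v.1 w.1 - Module.finrank ℝ F / φ z.1 * hessian G φ z.1 v.1 w.1 +
      (ricci K z.2 v.2 w.2 - (φ z.1 * metricTrace (G z.1) (hessian G φ z.1) +
        ((Module.finrank ℝ F : ℝ) - 1) * fderiv ℝ φ z.1 (gradient G φ z.1)) *
          K z.2 v.2 w.2) := by
  have h1 : LinearMap.fst ℝ E F ∘ₗ curvatureLinear (hG.warped hφ h0 hK) v w ∘ₗ
      LinearMap.inl ℝ E F = curvatureLinear hG v.1 w.1 -
        (φ z.1 * K z.2 v.2 w.2) • covGradient hG φ := by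
    ext u
    exact curvature_warped_fst hG hφ h0 hK u v w
  have h2 : LinearMap.snd ℝ E F ∘ₗ curvatureLinear (hG.warped hφ h0 hK) v w ∘ₗ
      LinearMap.inr ℝ E F = curvatureLinear hK v.2 w.2 -
        ((φ z.1)⁻¹ * hessian G φ z.1 v.1 w.1) • LinearMap.id -
        (fderiv ℝ φ z.1 (gradient G φ z.1) * K z.2 v.2 w.2) • LinearMap.id +
        fderiv ℝ φ z.1 (gradient G φ z.1) •
          (K z.2 w.2 : F →ₗ[ℝ] ℝ).smulRight v.2 := by
    ext u
    refine (curvature_warped_snd hG hφ h0 hK u v w).trans ?_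
    simp [hK.symm z.2 u w.2, mul_smul]
  rw [ricci_eq_trace (hG.warped hφ h0 hK), LinearMap.trace_prod_eq, h1, h2]
  simp only [map_add, map_sub, map_smul, LinearMap.trace_id, LinearMap.trace_smulRight,
    smul_eq_mul, ← ricci_eq_trace, ← metricTrace_hessian hG hφ, ContinuousLinearMap.coe_coe,
    hK.symm z.2 w.2 v.2]
  ring

theorem hessian_warped_fst (hG : IsMetricAt G z.1) (hφ : ContDiffAt ℝ 2 φ z.1)
    (h0 : φ z.1 ≠ 0) (hK : IsMetricAt K z.2) {u : E → ℝ} (hu : ContDiffAt ℝ 2 u z.1)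
    (v w : E × F) :
    hessian (warped G φ K) (u ∘ Prod.fst) z v w = hessian G u z.1 v.1 w.1 +
      φ z.1 * fderiv ℝ u z.1 (gradient G φ z.1) * K z.2 v.2 w.2 := by
  have h1 : (fun y : E × F ↦ fderiv ℝ (u ∘ Prod.fst) y w) =ᶠ[𝓝 z]
      (fun y ↦ fderiv ℝ u y w.1) ∘ Prod.fst := by
    filter_upwards [continuousAt_fst.eventually (hu.eventually (by simp))] with y hy
    rw [((hy.differentiableAt (by norm_num)).hasFDerivAt.comp y hasFDerivAt_fst).fderiv]
    rfl
  have hd := (differentiableAt_fderiv_of_contDiffAt hu).hasFDerivAt.clm_apply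
    (hasFDerivAt_const w.1 z.1)
  unfold hessian
  rw [h1.fderiv_eq, (hd.differentiableAt.hasFDerivAt.comp z hasFDerivAt_fst).fderiv,
    ((hu.differentiableAt (by norm_num)).hasFDerivAt.comp z hasFDerivAt_fst).fderiv,
    christoffel_warped hG hφ h0 hK]
  simp
  ring

/-- The corrections are purely mixed, so they disappear on both diagonal blocks and leave no trace
in the Laplacian. -/
theorem hessian_warped_snd (hG : IsMetricAt G z.1) (hφ : ContDiffAt ℝ 2 φ z.1)
    (h0 : φ z.1 ≠ 0) (hK : IsMetricAt K z.2) {u : F → ℝ} (hu : ContDiffAt ℝ 2 u z.2)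
    (v w : E × F) :
    hessian (warped G φ K) (u ∘ Prod.snd) z v w = hessian K u z.2 v.2 w.2 -
      ((φ z.1)⁻¹ * fderiv ℝ φ z.1 v.1 * fderiv ℝ u z.2 w.2 +
        (φ z.1)⁻¹ * fderiv ℝ φ z.1 w.1 * fderiv ℝ u z.2 v.2) := by
  have h1 : (fun y : E × F ↦ fderiv ℝ (u ∘ Prod.snd) y w) =ᶠ[𝓝 z]
      (fun y ↦ fderiv ℝ u y w.2) ∘ Prod.snd := by
    filter_upwards [continuousAt_snd.eventually (hu.eventually (by simp))] with y hy
    rw [((hy.differentiableAt (by norm_num)).hasFDerivAt.comp y hasFDerivAt_snd).fderiv]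
    rfl
  have hd := (differentiableAt_fderiv_of_contDiffAt hu).hasFDerivAt.clm_apply
    (hasFDerivAt_const w.2 z.2)
  unfold hessian
  rw [h1.fderiv_eq, (hd.differentiableAt.hasFDerivAt.comp z hasFDerivAt_snd).fderiv,
    ((hu.differentiableAt (by norm_num)).hasFDerivAt.comp z hasFDerivAt_snd).fderiv,
    christoffel_warped hG hφ h0 hK]
  simp
  ring

end Ricci

end LocalGeometry

/-! ### Manifold objects read in the preferred chart -/

section Charts

set_option synthInstance.maxHeartbeats 200000

variable {E : Type*} [NormedAddCommGroup E] [NormedSpace ℝ E]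
  {H : Type*} [TopologicalSpace H] {I : ModelWithCorners ℝ E H}
  {M : Type*} [TopologicalSpace M] [ChartedSpace H M]
  {E' : Type*} [NormedAddCommGroup E'] [NormedSpace ℝ E']
  {H' : Type*} [TopologicalSpace H'] {J : ModelWithCorners ℝ E' H'}
  {M' : Type*} [TopologicalSpace M'] [ChartedSpace H' M']

/-- The tangent space at `p` is identified with the model space through this very chart, so at the
base point chart and manifold objects coincide. -/
theorem mfderiv_extChartAt_symm_self [I.Boundaryless] [IsManifold I ∞ M] (p : M) :
    mfderiv 𝓘(ℝ, E) I (extChartAt I p).symm (extChartAt I p p) = ContinuousLinearMap.id ℝ E := by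
  have : IsManifold I 1 M := .of_le (n := ∞) (by simp)
  have h := mfderivWithin_range_extChartAt_symm (I := I) (x := p)
  rw [I.range_eq_univ, mfderivWithin_univ] at h
  exact h

theorem mdifferentiableAt_extChartAt_symm [I.Boundaryless] [IsManifold I ∞ M]
    {p : M} {y : E} (hy : y ∈ (extChartAt I p).target) :
    MDifferentiableAt 𝓘(ℝ, E) I (extChartAt I p).symm y := by
  have : IsManifold I 1 M := .of_le (n := ∞) (by simp)
  have h := mdifferentiableWithinAt_extChartAt_symm (I := I) hy
  rwa [I.range_eq_univ, mdifferentiableWithinAt_univ] at h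

theorem contDiffAt_comp_extChartAt_symm [I.Boundaryless] {V : Type*}
    [NormedAddCommGroup V] [NormedSpace ℝ V] {u : M → V} {p : M}
    (hu : ContMDiffAt I 𝓘(ℝ, V) ∞ u p) :
    ContDiffAt ℝ 2 (u ∘ (extChartAt I p).symm) (extChartAt I p p) := by
  have h := (contMDiffAt_iff.1 hu).2
  rw [I.range_eq_univ, contDiffWithinAt_univ] at h
  exact h.of_le (m := 2) (WithTop.coe_le_coe.2 (le_top : (2 : ℕ∞) ≤ ⊤))

theorem fderiv_comp_extChartAt_symm [I.Boundaryless] {u : M → ℝ}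
    (hu : ContMDiff I 𝓘(ℝ) ∞ u) (p : M) :
    fderiv ℝ (u ∘ (extChartAt I p).symm) (extChartAt I p p) = differential I u p := by
  have h : MDifferentiableAt I 𝓘(ℝ) u p := (hu p).mdifferentiableAt (by simp)
  unfold differential
  rw [h.mfderiv, I.range_eq_univ, fderivWithin_univ]
  rfl

theorem comp_extChartAt_symm_ne_zero {f : M → ℝ} (p : M)
    (hpos : ∀ x, 0 < f x) :
    (f ∘ (extChartAt I p).symm) (extChartAt I p p) ≠ 0 := (hpos _).ne'

theorem differential_comp_fst {u : M → ℝ} (hu : ContMDiff I 𝓘(ℝ) ∞ u) (p : M × M')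
    (v : E × E') : differential (I.prod J) (u ∘ Prod.fst) p v = differential I u p.1 v.1 := by
  have h := mfderiv_comp p ((hu p.1).mdifferentiableAt (by simp))
    (mdifferentiableAt_fst (I := I) (I' := J))
  rw [mfderiv_fst] at h
  exact congrArg (fun L : (E × E') →L[ℝ] ℝ ↦ L v) h

theorem differential_comp_snd {u : M' → ℝ} (hu : ContMDiff J 𝓘(ℝ) ∞ u) (p : M × M')
    (v : E × E') : differential (I.prod J) (u ∘ Prod.snd) p v = differential J u p.2 v.2 := by
  have h := mfderiv_comp p ((hu p.2).mdifferentiableAt (by simp))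
    (mdifferentiableAt_snd (I := I) (I' := J))
  rw [mfderiv_snd] at h
  exact congrArg (fun L : (E × E') →L[ℝ] ℝ ↦ L v) h

theorem differential_sub_mul_log [I.Boundaryless] {f h : M → ℝ} (hf : ContMDiff I 𝓘(ℝ) ∞ f)
    (hpos : ∀ x, 0 < f x) (hh : ContMDiff I 𝓘(ℝ) ∞ h) (c : ℝ) (p : M)
    (v : TangentSpace I p) :
    differential I (fun x ↦ h x - c * Real.log (f x)) p v =
      differential I h p v - c / f p * differential I f p v := by
  have hs : ContMDiff I 𝓘(ℝ) ∞ (fun x ↦ h x - c * Real.log (f x)) := fun x ↦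
    (hh x).sub (contMDiffAt_const.mul
      ((Real.contDiffAt_log.2 (hpos x).ne').contMDiffAt.comp x (hf x)))
  rw [← fderiv_comp_extChartAt_symm hs, ← fderiv_comp_extChartAt_symm hh,
    ← fderiv_comp_extChartAt_symm hf]
  have d1 := ((contDiffAt_comp_extChartAt_symm (hh p)).differentiableAt
    (by norm_num)).hasFDerivAt
  have d2 := ((contDiffAt_comp_extChartAt_symm (hf p)).differentiableAt
    (by norm_num)).hasFDerivAt
  have d3 := d1.sub ((d2.log (comp_extChartAt_symm_ne_zero p hpos)).const_mul c)
  refine (congrArg (fun L : E →L[ℝ] ℝ ↦ L v) d3.fderiv).trans ?_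
  have key : ∀ v : E, fderiv ℝ (h ∘ (extChartAt I p).symm) (extChartAt I p p) v -
      c * ((f ((extChartAt I p).symm (extChartAt I p p)))⁻¹ *
        fderiv ℝ (f ∘ (extChartAt I p).symm) (extChartAt I p p) v) =
      fderiv ℝ (h ∘ (extChartAt I p).symm) (extChartAt I p p) v -
        c / f p * fderiv ℝ (f ∘ (extChartAt I p).symm) (extChartAt I p p) v := fun v ↦ by
    rw [extChartAt_to_inv]
    ring
  exact key v

namespace SemiRiemannianMetric

variable [IsManifold I ∞ M] (g : SemiRiemannianMetric I M)

theorem inChart_apply (p : M) (x v w : E) :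
    g.inChart p x v w = g.val ((extChartAt I p).symm x)
      (mfderiv 𝓘(ℝ, E) I (extChartAt I p).symm x v)
      (mfderiv 𝓘(ℝ, E) I (extChartAt I p).symm x w) := rfl

theorem inChart_self [I.Boundaryless] (p : M) : g.inChart p (extChartAt I p p) = g.val p := by
  ext v w
  rw [inChart_apply, mfderiv_extChartAt_symm_self, extChartAt_to_inv]
  rfl

theorem inChart_symm (p : M) (x v w : E) : g.inChart p x v w = g.inChart p x w v :=
  g.symm _ _ _

theorem val_isInvertible [FiniteDimensional ℝ E] (p : M) :
    (g.val p : E →L[ℝ] E →L[ℝ] ℝ).IsInvertible :=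
  ContinuousLinearMap.isInvertible_of_nondegenerate (E := E) (g.nondegenerate p)

theorem exists_val_ne_zero [Nontrivial E] (p : M) :
    ∃ v w : TangentSpace I p, g.val p v w ≠ 0 := by
  obtain ⟨v, hv⟩ := exists_ne (0 : E)
  by_contra! h
  exact hv (g.nondegenerate p v (h v))

/-- Smoothness of `g` is stated in the bundle trivialization at `p`; on the chart target the inverse
of that trivialization is the derivative of the inverse chart. -/
theorem contDiffAt_inChart [I.Boundaryless] (p : M) :
    ContDiffAt ℝ 2 (g.inChart p) (extChartAt I p p) := by
  have : IsManifold I 1 M := .of_le (n := ∞) (by simp)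
  have h := g.contMDiff p
  rw [contMDiffAt_hom_bundle] at h
  refine (contDiffAt_comp_extChartAt_symm h.2).congr_of_eventuallyEq ?_
  filter_upwards [extChartAt_target_mem_nhds (I := I) p] with y hy
  have hs : (extChartAt I p).symm y ∈ (chartAt H p).source := by
    rw [← extChartAt_source (I := I)]
    exact (extChartAt I p).map_target hy
  have hb : (extChartAt I p).symm y ∈ (trivializationAt E (TangentSpace I) p).baseSet := hs
  have key : ∀ v : E, (trivializationAt E (TangentSpace I) p).symm ((extChartAt I p).symm y) v =
      mfderiv 𝓘(ℝ, E) I (extChartAt I p).symm y v := fun v ↦ by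
    have h1 := TangentBundle.symmL_trivializationAt (I := I) hs
    rw [(extChartAt I p).right_inv hy, I.range_eq_univ, mfderivWithin_univ] at h1
    exact (Bundle.Trivialization.symmL_apply _ hb v).symm.trans
      (congrArg (fun L : E →L[ℝ] E ↦ L v) h1)
  ext v w
  simp only [Function.comp_apply]
  rw [inCoordinates_apply_eq₂ hb hb (Set.mem_univ _), key, key, inChart_apply]
  simp

theorem isMetricAt_inChart [I.Boundaryless] [FiniteDimensional ℝ E] (p : M) :
    LocalGeometry.IsMetricAt (g.inChart p) (extChartAt I p p) :=
  ⟨g.contDiffAt_inChart p, g.inChart_symm p, by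
    rw [inChart_self]
    exact g.val_isInvertible p⟩

theorem gradient_inChart [I.Boundaryless] {u : M → ℝ} (hu : ContMDiff I 𝓘(ℝ) ∞ u) (p : M) :
    LocalGeometry.gradient (g.inChart p) (u ∘ (extChartAt I p).symm) (extChartAt I p p) =
      g.grad u p := by
  rw [LocalGeometry.gradient, fderiv_comp_extChartAt_symm hu, inChart_self]
  rfl

theorem val_grad [FiniteDimensional ℝ E] (u : M → ℝ) (p : M) (v : TangentSpace I p) :
    g.val p (g.grad u p) v = differential I u p v :=
  congrArg (fun L : E →L[ℝ] ℝ ↦ L v)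
    ((g.val_isInvertible p).self_apply_inverse (differential I u p))

theorem eq_grad [FiniteDimensional ℝ E] {u : M → ℝ} {p : M} {v : TangentSpace I p}
    (h : ∀ w, g.val p v w = differential I u p w) : g.grad u p = v :=
  (g.val_isInvertible p).inverse_apply_eq.2 (ContinuousLinearMap.ext fun w ↦ (h w).symm)

theorem metricTrace_inChart [I.Boundaryless] [FiniteDimensional ℝ E] (u : M → ℝ) (p : M) :
    LocalGeometry.metricTrace (g.inChart p (extChartAt I p p))
      (LocalGeometry.hessian (g.inChart p) (u ∘ (extChartAt I p).symm) (extChartAt I p p)) =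
      g.laplacian u p := by
  rw [inChart_self]
  rfl

end SemiRiemannianMetric

/-! ### The warped product metric, its gradients and its chart expression -/

section Warped

variable [IsManifold I ∞ M] [IsManifold J ∞ M'] [FiniteDimensional ℝ E] [FiniteDimensional ℝ E']
  (gB : SemiRiemannianMetric I M) (gF : SemiRiemannianMetric J M')
  {f : M → ℝ} (hf : ContMDiff I 𝓘(ℝ) ∞ f) (hpos : ∀ x, 0 < f x)

theorem warpedProduct_val (p : M × M') :
    (warpedProduct gB f hf hpos gF).val p =
      LocalGeometry.warpedForm (E := E) (F := E') (gB.val p.1) (f p.1) (gF.val p.2) := by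
  refine ContinuousLinearMap.ext fun v ↦ ContinuousLinearMap.ext fun w ↦ ?_
  change gB.val p.1 (mfderiv (I.prod J) I Prod.fst p v) (mfderiv (I.prod J) I Prod.fst p w) +
    f p.1 ^ 2 * gF.val p.2 (mfderiv (I.prod J) J Prod.snd p v)
      (mfderiv (I.prod J) J Prod.snd p w) = _
  rw [mfderiv_fst, mfderiv_snd]
  rfl

theorem warpedProduct_val_apply (p : M × M') (v w : E × E') :
    (warpedProduct gB f hf hpos gF).val p v w =
      gB.val p.1 v.1 w.1 + f p.1 ^ 2 * gF.val p.2 v.2 w.2 := by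
  rw [warpedProduct_val]
  rfl

theorem grad_warpedProduct_fst {u : M → ℝ} (hu : ContMDiff I 𝓘(ℝ) ∞ u) (p : M × M') :
    (warpedProduct gB f hf hpos gF).grad (u ∘ Prod.fst) p = ((gB.grad u p.1, 0) : E × E') := by
  refine SemiRiemannianMetric.eq_grad _ fun w ↦ ?_
  refine (warpedProduct_val_apply gB gF hf hpos p _ w).trans
    (Eq.trans ?_ (differential_comp_fst hu p w).symm)
  have h : gF.val p.2 (0 : E') (w : E × E').2 = 0 :=
    congrArg (fun L : E' →L[ℝ] ℝ ↦ L (w : E × E').2) (map_zero (gF.val p.2))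
  have h' := gB.val_grad u p.1 (w : E × E').1
  change gB.val p.1 (gB.grad u p.1) (w : E × E').1 +
    f p.1 ^ 2 * gF.val p.2 (0 : E') (w : E × E').2 = _
  rw [h, h', mul_zero, add_zero]

theorem val_grad_warpedProduct_fst {u h : M → ℝ} (hu : ContMDiff I 𝓘(ℝ) ∞ u)
    (hh : ContMDiff I 𝓘(ℝ) ∞ h) (p : M × M') :
    (warpedProduct gB f hf hpos gF).val p
      ((warpedProduct gB f hf hpos gF).grad (u ∘ Prod.fst) p)
      ((warpedProduct gB f hf hpos gF).grad (h ∘ Prod.fst) p) =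
      gB.val p.1 (gB.grad u p.1) (gB.grad h p.1) := by
  rw [SemiRiemannianMetric.val_grad, grad_warpedProduct_fst gB gF hf hpos hh,
    differential_comp_fst hu, gB.val_grad]

/-- The gradient of `h ∘ π` is horizontal, and `d(u ∘ σ)` kills horizontal vectors. -/
theorem val_grad_warpedProduct_snd {u : M' → ℝ} {h : M → ℝ} (hu : ContMDiff J 𝓘(ℝ) ∞ u)
    (hh : ContMDiff I 𝓘(ℝ) ∞ h) (p : M × M') :
    (warpedProduct gB f hf hpos gF).val p
      ((warpedProduct gB f hf hpos gF).grad (u ∘ Prod.snd) p)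
      ((warpedProduct gB f hf hpos gF).grad (h ∘ Prod.fst) p) = 0 := by
  rw [SemiRiemannianMetric.val_grad, grad_warpedProduct_fst gB gF hf hpos hh,
    differential_comp_snd hu]
  exact map_zero (differential J u p.2)

/-- The preferred chart of a product is the product of the preferred charts, so its inverse commutes
with both projections; the chain rule then applies on the chart target. -/
theorem inChart_warpedProduct [I.Boundaryless] [J.Boundaryless] (p : M × M') :
    (warpedProduct gB f hf hpos gF).inChart p =ᶠ[𝓝 (extChartAt (I.prod J) p p)]
      LocalGeometry.warped (gB.inChart p.1) (f ∘ (extChartAt I p.1).symm) (gF.inChart p.2) := by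
  filter_upwards [extChartAt_target_mem_nhds (I := I.prod J) p] with z hz
  have hz' : z.1 ∈ (extChartAt I p.1).target ∧ z.2 ∈ (extChartAt J p.2).target := by
    rw [extChartAt_prod] at hz
    exact hz
  have e1 : Prod.fst ∘ (extChartAt (I.prod J) p).symm = (extChartAt I p.1).symm ∘ Prod.fst := by
    rw [extChartAt_prod]
    rfl
  have e2 : Prod.snd ∘ (extChartAt (I.prod J) p).symm = (extChartAt J p.2).symm ∘ Prod.snd := by
    rw [extChartAt_prod]
    rfl
  have hd := mdifferentiableAt_extChartAt_symm (I := I.prod J) hz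
  have d1 : ∀ v : E × E', mfderiv (I.prod J) I Prod.fst ((extChartAt (I.prod J) p).symm z)
      (mfderiv 𝓘(ℝ, E × E') (I.prod J) (extChartAt (I.prod J) p).symm z v) =
      mfderiv 𝓘(ℝ, E) I (extChartAt I p.1).symm z.1 v.1 := fun v ↦ by
    have h1 := mfderiv_comp z (mdifferentiableAt_fst (I := I) (I' := J)) hd
    have h2 := mfderiv_comp z (mdifferentiableAt_extChartAt_symm (I := I) hz'.1)
      (differentiableAt_fst (𝕜 := ℝ) (p := z)).mdifferentiableAt
    rw [e1, h2, mfderiv_eq_fderiv, fderiv_fst] at h1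
    exact (congrArg (fun L : (E × E') →L[ℝ] E ↦ L v) h1).symm
  have d2 : ∀ v : E × E', mfderiv (I.prod J) J Prod.snd ((extChartAt (I.prod J) p).symm z)
      (mfderiv 𝓘(ℝ, E × E') (I.prod J) (extChartAt (I.prod J) p).symm z v) =
      mfderiv 𝓘(ℝ, E') J (extChartAt J p.2).symm z.2 v.2 := fun v ↦ by
    have h1 := mfderiv_comp z (mdifferentiableAt_snd (I := I) (I' := J)) hd
    have h2 := mfderiv_comp z (mdifferentiableAt_extChartAt_symm (I := J) hz'.2)
      (differentiableAt_snd (𝕜 := ℝ) (p := z)).mdifferentiableAt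
    rw [e2, h2, mfderiv_eq_fderiv, fderiv_snd] at h1
    exact (congrArg (fun L : (E × E') →L[ℝ] E' ↦ L v) h1).symm
  have k1 : ((extChartAt (I.prod J) p).symm z).1 = (extChartAt I p.1).symm z.1 := congrFun e1 z
  have k2 : ((extChartAt (I.prod J) p).symm z).2 = (extChartAt J p.2).symm z.2 := congrFun e2 z
  refine ContinuousLinearMap.ext fun v ↦ ContinuousLinearMap.ext fun w ↦ ?_
  change gB.val ((extChartAt (I.prod J) p).symm z).1
      (mfderiv (I.prod J) I Prod.fst ((extChartAt (I.prod J) p).symm z)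
        (mfderiv 𝓘(ℝ, E × E') (I.prod J) (extChartAt (I.prod J) p).symm z v))
      (mfderiv (I.prod J) I Prod.fst ((extChartAt (I.prod J) p).symm z)
        (mfderiv 𝓘(ℝ, E × E') (I.prod J) (extChartAt (I.prod J) p).symm z w)) +
    f ((extChartAt (I.prod J) p).symm z).1 ^ 2 * gF.val ((extChartAt (I.prod J) p).symm z).2
      (mfderiv (I.prod J) J Prod.snd ((extChartAt (I.prod J) p).symm z)
        (mfderiv 𝓘(ℝ, E × E') (I.prod J) (extChartAt (I.prod J) p).symm z v))
      (mfderiv (I.prod J) J Prod.snd ((extChartAt (I.prod J) p).symm z)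
        (mfderiv 𝓘(ℝ, E × E') (I.prod J) (extChartAt (I.prod J) p).symm z w)) = _
  rw [d1, d1, d2, d2, k1, k2]
  rfl

end Warped

end Charts

/-! ### Ricci tensor, Hessian and Laplacian of the warped product -/

section WarpedCurvature

set_option synthInstance.maxHeartbeats 200000

variable {E : Type*} [NormedAddCommGroup E] [NormedSpace ℝ E] [FiniteDimensional ℝ E]
  {H : Type*} [TopologicalSpace H] {I : ModelWithCorners ℝ E H} [I.Boundaryless]
  {M : Type*} [TopologicalSpace M] [ChartedSpace H M] [IsManifold I ∞ M]
  {E' : Type*} [NormedAddCommGroup E'] [NormedSpace ℝ E'] [FiniteDimensional ℝ E']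
  {H' : Type*} [TopologicalSpace H'] {J : ModelWithCorners ℝ E' H'} [J.Boundaryless]
  {M' : Type*} [TopologicalSpace M'] [ChartedSpace H' M'] [IsManifold J ∞ M']
  (gB : SemiRiemannianMetric I M) (gF : SemiRiemannianMetric J M')
  {f : M → ℝ} (hf : ContMDiff I 𝓘(ℝ) ∞ f) (hpos : ∀ x, 0 < f x)

theorem SemiRiemannianMetric.ricci_zero_left (p : M) (w : TangentSpace I p) :
    gB.ricci p 0 w = 0 :=
  LocalGeometry.ricci_zero_left (gB.isMetricAt_inChart p) w

theorem SemiRiemannianMetric.hessian_zero_left (u : M → ℝ) (p : M) (w : TangentSpace I p) :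
    gB.hessian u p 0 w = 0 :=
  LocalGeometry.hessian_zero_left (gB.isMetricAt_inChart p) _ w

theorem ricci_warpedProduct (p : M × M') (v w : E × E') :
    (warpedProduct gB f hf hpos gF).ricci p v w =
      gB.ricci p.1 v.1 w.1 - Module.finrank ℝ E' / f p.1 * gB.hessian f p.1 v.1 w.1 +
      (gF.ricci p.2 v.2 w.2 - (f p.1 * gB.laplacian f p.1 +
        ((Module.finrank ℝ E' : ℝ) - 1) * gB.val p.1 (gB.grad f p.1) (gB.grad f p.1)) *
          gF.val p.2 v.2 w.2) := by
  have h := LocalGeometry.ricci_warped (z := (extChartAt I p.1 p.1, extChartAt J p.2 p.2))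
    (gB.isMetricAt_inChart p.1) (contDiffAt_comp_extChartAt_symm (hf p.1))
    (comp_extChartAt_symm_ne_zero p.1 hpos) (gF.isMetricAt_inChart p.2) v w
  simp only [gB.metricTrace_inChart, gB.gradient_inChart hf, fderiv_comp_extChartAt_symm hf,
    gF.inChart_self, Function.comp_apply, extChartAt_to_inv] at h
  rw [gB.val_grad]
  exact (LocalGeometry.ricci_congr (inChart_warpedProduct gB gF hf hpos p) v w).trans h

theorem hessian_warpedProduct_fst {u : M → ℝ} (hu : ContMDiff I 𝓘(ℝ) ∞ u) (p : M × M')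
    (v w : E × E') :
    (warpedProduct gB f hf hpos gF).hessian (u ∘ Prod.fst) p v w =
      gB.hessian u p.1 v.1 w.1 +
        f p.1 * differential I u p.1 (gB.grad f p.1) * gF.val p.2 v.2 w.2 := by
  have h := LocalGeometry.hessian_warped_fst
    (z := (extChartAt I p.1 p.1, extChartAt J p.2 p.2))
    (gB.isMetricAt_inChart p.1) (contDiffAt_comp_extChartAt_symm (hf p.1))
    (comp_extChartAt_symm_ne_zero p.1 hpos) (gF.isMetricAt_inChart p.2)
    (contDiffAt_comp_extChartAt_symm (hu p.1)) v w
  simp only [gB.gradient_inChart hf, fderiv_comp_extChartAt_symm hu,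
    gF.inChart_self, Function.comp_apply, extChartAt_to_inv] at h
  exact (LocalGeometry.hessian_congr (inChart_warpedProduct gB gF hf hpos p)
    (φ' := (u ∘ (extChartAt I p.1).symm) ∘ Prod.fst) (by rw [extChartAt_prod]; rfl) v w).trans h

theorem hessian_warpedProduct_snd {u : M' → ℝ} (hu : ContMDiff J 𝓘(ℝ) ∞ u) (p : M × M')
    (v w : E × E') :
    (warpedProduct gB f hf hpos gF).hessian (u ∘ Prod.snd) p v w =
      gF.hessian u p.2 v.2 w.2 -
        ((f p.1)⁻¹ * differential I f p.1 v.1 * differential J u p.2 w.2 +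
          (f p.1)⁻¹ * differential I f p.1 w.1 * differential J u p.2 v.2) := by
  have h := LocalGeometry.hessian_warped_snd
    (z := (extChartAt I p.1 p.1, extChartAt J p.2 p.2))
    (gB.isMetricAt_inChart p.1) (contDiffAt_comp_extChartAt_symm (hf p.1))
    (comp_extChartAt_symm_ne_zero p.1 hpos) (gF.isMetricAt_inChart p.2)
    (contDiffAt_comp_extChartAt_symm (hu p.2)) v w
  simp only [fderiv_comp_extChartAt_symm hu, fderiv_comp_extChartAt_symm hf,
    Function.comp_apply, extChartAt_to_inv] at h
  exact (LocalGeometry.hessian_congr (inChart_warpedProduct gB gF hf hpos p)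
    (φ' := (u ∘ (extChartAt J p.2).symm) ∘ Prod.snd) (by rw [extChartAt_prod]; rfl) v w).trans h

theorem laplacian_warpedProduct {u : M × M' → ℝ} (hu : ContMDiff (I.prod J) 𝓘(ℝ) ∞ u)
    (p : M × M') :
    (warpedProduct gB f hf hpos gF).laplacian u p =
      LocalGeometry.metricTrace (E := E) (gB.val p.1) (fun v w ↦
          (warpedProduct gB f hf hpos gF).hessian u p ((v, 0) : E × E') ((w, 0) : E × E')) +
        (f p.1 ^ 2)⁻¹ * LocalGeometry.metricTrace (E := E') (gF.val p.2) (fun v w ↦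
          (warpedProduct gB f hf hpos gF).hessian u p ((0, v) : E × E') ((0, w) : E × E')) := by
  have hW := (warpedProduct gB f hf hpos gF).isMetricAt_inChart p
  -- Splitting the trace needs an endomorphism representing the Hessian: the covariant derivative of
  -- the gradient.
  have hA := LocalGeometry.apply_covGradient hW (contDiffAt_comp_extChartAt_symm (hu p))
  rw [SemiRiemannianMetric.inChart_self, warpedProduct_val] at hA
  have h := LocalGeometry.metricTrace_warpedForm (E := E) (F := E')
    (gB.val_isInvertible p.1) (hpos p.1).ne'
    (gF.val_isInvertible p.2) (gB.symm p.1) (gF.symm p.2) hA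
  unfold SemiRiemannianMetric.laplacian
  rw [warpedProduct_val]
  exact h

/-- The fiber part of the Hessian is `f du(∇f) g_F`; its trace is `m f du(∇f)`, and the factor `f⁻²`
turns this into the drift term. -/
theorem laplacian_warpedProduct_fst {u : M → ℝ} (hu : ContMDiff I 𝓘(ℝ) ∞ u) (p : M × M') :
    (warpedProduct gB f hf hpos gF).laplacian (u ∘ Prod.fst) p =
      gB.laplacian u p.1 +
        Module.finrank ℝ E' / f p.1 * differential I u p.1 (gB.grad f p.1) := by
  rw [laplacian_warpedProduct gB gF hf hpos (hu.comp contMDiff_fst)]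
  simp only [hessian_warpedProduct_fst gB gF hf hpos hu]
  have h1 : ∀ w : E', gF.val p.2 (0 : E') w = 0 := fun w ↦
    congrArg (fun L : E' →L[ℝ] ℝ ↦ L w) (map_zero (gF.val p.2))
  have h2 : ∀ w : E, gB.hessian u p.1 (0 : E) w = 0 := gB.hessian_zero_left u p.1
  simp only [h1, h2, mul_zero, add_zero, zero_add]
  have h3 := LocalGeometry.metricTrace_const_mul_self (E := E') (gF.symm p.2)
    (gF.val_isInvertible p.2)
    (f p.1 * differential I u p.1 (gB.grad f p.1))
  have h0 := (hpos p.1).ne'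
  refine (congrArg (fun t : ℝ ↦ gB.laplacian u p.1 + (f p.1 ^ 2)⁻¹ * t) h3).trans ?_
  field_simp

theorem laplacian_warpedProduct_snd {u : M' → ℝ} (hu : ContMDiff J 𝓘(ℝ) ∞ u) (p : M × M') :
    (warpedProduct gB f hf hpos gF).laplacian (u ∘ Prod.snd) p =
      (f p.1 ^ 2)⁻¹ * gF.laplacian u p.2 := by
  rw [laplacian_warpedProduct gB gF hf hpos (hu.comp contMDiff_snd)]
  simp only [hessian_warpedProduct_snd gB gF hf hpos hu]
  have h1 : differential I f p.1 (0 : E) = 0 := map_zero (differential I f p.1)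
  have h2 : differential J u p.2 (0 : E') = 0 := map_zero (differential J u p.2)
  have h3 : ∀ w : E', gF.hessian u p.2 (0 : E') w = 0 := gF.hessian_zero_left u p.2
  simp only [h1, h2, h3, mul_zero, add_zero, zero_mul, sub_zero]
  have h4 : LocalGeometry.metricTrace (E := E) (gB.val p.1) (fun _ _ ↦ 0) = 0 := by
    simp [LocalGeometry.metricTrace]
  rw [h4, zero_add]
  rfl

theorem driftLaplacian_sub_mul_log {f h u : M → ℝ} (hf : ContMDiff I 𝓘(ℝ) ∞ f)
    (hpos : ∀ x, 0 < f x) (hh : ContMDiff I 𝓘(ℝ) ∞ h) (c : ℝ) (p : M) :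
    gB.driftLaplacian (fun x ↦ h x - c * Real.log (f x)) u p =
      gB.laplacian u p + c / f p * differential I u p (gB.grad f p) -
        gB.val p (gB.grad u p) (gB.grad h p) := by
  unfold SemiRiemannianMetric.driftLaplacian
  rw [gB.symm, gB.val_grad, differential_sub_mul_log hf hpos hh, gB.symm p (gB.grad u p),
    gB.val_grad, ← gB.val_grad f, gB.symm p (gB.grad f p), gB.val_grad]
  ring

end WarpedCurvature

/-! ### Separation of variables and the two equivalences -/

/-- Separation of variables for a pair of tensor equations on a product. -/
theorem forall_add_eq_zero_iff_separated {B F E E' : Type*} [Nonempty B] [Nonempty F] [Zero E]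
    [Zero E'] {A : B → E → E → ℝ} {R k : F → E' → E' → ℝ} {μ : B → ℝ} (hA : ∀ b, A b 0 0 = 0)
    (hR : ∀ q, R q 0 0 = 0) (hk : ∀ q, k q 0 0 = 0) (hne : ∀ q, ∃ v w, k q v w ≠ 0) :
    (∀ (p : B × F) (v w : E × E'),
        A p.1 v.1 w.1 + (R p.2 v.2 w.2 - μ p.1 * k p.2 v.2 w.2) = 0) ↔
      (∀ b v w, A b v w = 0) ∧ ∃ c, (∀ q v w, R q v w = c * k q v w) ∧ ∀ b, μ b = c := by
  constructor
  · intro h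
    obtain ⟨b₀⟩ := ‹Nonempty B›
    obtain ⟨q₀⟩ := ‹Nonempty F›
    have hF : ∀ b q v w, R q v w = μ b * k q v w := fun b q v w ↦ by
      have := h (b, q) (0, v) (0, w)
      simp only [hA] at this
      linarith
    refine ⟨fun b v w ↦ by simpa [hR, hk] using h (b, q₀) (v, 0) (w, 0), μ b₀, hF b₀, fun b ↦ ?_⟩
    -- Over one fiber point, `μ b` and `μ b₀` multiply the same nonzero value of `k`.
    obtain ⟨v, w, hvw⟩ := hne q₀
    exact mul_right_cancel₀ hvw ((hF b q₀ v w).symm.trans (hF b₀ q₀ v w))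
  · rintro ⟨h1, c, h2, h3⟩ p v w
    rw [h1, h2, h3]
    ring

end

theorem theorem1
    {EB : Type*} [NormedAddCommGroup EB] [NormedSpace ℝ EB] [FiniteDimensional ℝ EB]
    {HB : Type*} [TopologicalSpace HB] (I : ModelWithCorners ℝ EB HB) [I.Boundaryless]
    {B : Type*} [TopologicalSpace B] [ChartedSpace HB B] [IsManifold I ∞ B] [Nonempty B]
    {EF : Type*} [NormedAddCommGroup EF] [NormedSpace ℝ EF] [FiniteDimensional ℝ EF]
    {HF : Type*} [TopologicalSpace HF] (J : ModelWithCorners ℝ EF HF) [J.Boundaryless]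
    {F : Type*} [TopologicalSpace F] [ChartedSpace HF F] [IsManifold J ∞ F] [Nonempty F]
    (gB : SemiRiemannianMetric I B) (gF : SemiRiemannianMetric J F)
    (f : B → ℝ) (hf : ContMDiff I 𝓘(ℝ) ∞ f) (hpos : ∀ x, 0 < f x)
    (hB : B → ℝ) (hhB : ContMDiff I 𝓘(ℝ) ∞ hB)
    (θ lam : ℝ) (hθ : 0 ≤ θ) (m : ℕ) (hm : Module.finrank ℝ EF = m) (hm1 : 1 ≤ m) :
    (∀ uB : B → ℝ, ContMDiff I 𝓘(ℝ) ∞ uB →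
      ((warpedProduct gB f hf hpos gF).IsGRHS (hB ∘ Prod.fst) (uB ∘ Prod.fst) θ lam ↔
        (∀ (p : B) (v w : TangentSpace I p),
          gB.ricci p v w - m / f p * gB.hessian f p v w + gB.hessian hB p v w
            - θ * (differential I uB p v * differential I uB p w) = lam * gB.val p v w) ∧
        (∀ p : B, gB.driftLaplacian (fun x ↦ hB x - m * Real.log (f x)) uB p = 0) ∧
        ∃ μ : ℝ, gF.IsEinstein μ ∧
          ∀ p : B, f p * gB.laplacian f p + ((m : ℝ) - 1) * gB.val p (gB.grad f p) (gB.grad f p)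
            + lam * f p ^ 2 - f p * differential I hB p (gB.grad f p) = μ)) ∧
    (∀ uF : F → ℝ, ContMDiff J 𝓘(ℝ) ∞ uF →
      ((warpedProduct gB f hf hpos gF).IsGRHS (hB ∘ Prod.fst) (uF ∘ Prod.snd) θ lam ↔
        (∀ (p : B) (v w : TangentSpace I p),
          gB.ricci p v w - m / f p * gB.hessian f p v w + gB.hessian hB p v w
            = lam * gB.val p v w) ∧
        ∃ μ : ℝ, gF.IsHarmonicEinstein uF θ μ ∧
          ∀ p : B, f p * gB.laplacian f p + ((m : ℝ) - 1) * gB.val p (gB.grad f p) (gB.grad f p)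
            + lam * f p ^ 2 - f p * differential I hB p (gB.grad f p) = μ)) := by
  subst hm
  -- Here `m ≥ 1` enters: without a nonzero vertical vector nothing would force `μ` to be constant.
  have : Nontrivial EF := Module.nontrivial_of_finrank_pos (R := ℝ) hm1
  have dB0 : ∀ (u : B → ℝ) (b : B), differential I u b (0 : EB) = 0 :=
    fun u b ↦ map_zero (differential I u b)
  have dF0 : ∀ (u : F → ℝ) (q : F), differential J u q (0 : EF) = 0 :=
    fun u q ↦ map_zero (differential J u q)
  have vB0 : ∀ (b : B) (w : EB), gB.val b (0 : EB) w = 0 :=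
    fun b w ↦ congrArg (fun L : EB →L[ℝ] ℝ ↦ L w) (map_zero (gB.val b))
  have vF0 : ∀ (q : F) (w : EF), gF.val q (0 : EF) w = 0 :=
    fun q w ↦ congrArg (fun L : EF →L[ℝ] ℝ ↦ L w) (map_zero (gF.val q))
  have rB0 : ∀ (b : B) (w : EB), gB.ricci b (0 : EB) w = 0 := fun b ↦ gB.ricci_zero_left b
  have rF0 : ∀ (q : F) (w : EF), gF.ricci q (0 : EF) w = 0 := fun q ↦ gF.ricci_zero_left q
  have hB0 : ∀ (u : B → ℝ) (b : B) (w : EB), gB.hessian u b (0 : EB) w = 0 :=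
    fun u b ↦ gB.hessian_zero_left u b
  have hh : ContMDiff (I.prod J) 𝓘(ℝ) ∞ (hB ∘ Prod.fst : B × F → ℝ) := hhB.comp contMDiff_fst
  set W := warpedProduct gB f hf hpos gF with hW
  set μ : B → ℝ := fun p ↦ f p * gB.laplacian f p +
    ((Module.finrank ℝ EF : ℝ) - 1) * gB.val p (gB.grad f p) (gB.grad f p)
      + lam * f p ^ 2 - f p * differential I hB p (gB.grad f p) with hμ
  -- The coefficient of `g_F` collects `-(f Δf + (m - 1)|∇f|²)` from `Ric`, `f dh_B(∇f)` from `Hess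
  -- h` and `-λ f²` from the metric, which is `-μ`.
  have tensor : ∀ (p : B × F) (v w : EB × EF),
      W.ricci p v w + W.hessian (hB ∘ Prod.fst) p v w - lam * W.val p v w =
      (gB.ricci p.1 v.1 w.1 - Module.finrank ℝ EF / f p.1 * gB.hessian f p.1 v.1 w.1 +
        gB.hessian hB p.1 v.1 w.1 - lam * gB.val p.1 v.1 w.1) +
      (gF.ricci p.2 v.2 w.2 - μ p.1 * gF.val p.2 v.2 w.2) := fun p v w ↦ by
    rw [hW, ricci_warpedProduct, hessian_warpedProduct_fst gB gF hf hpos hhB,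
      warpedProduct_val_apply]
    simp only [hμ]
    ring
  constructor
  · intro uB huB
    -- Here `du` is horizontal, so the `θ` term belongs to the base tensor `A`.
    have sep := forall_add_eq_zero_iff_separated (B := B) (F := F) (E := EB) (E' := EF)
      (A := fun b v w ↦ gB.ricci b v w - Module.finrank ℝ EF / f b * gB.hessian f b v w +
        gB.hessian hB b v w - lam * gB.val b v w -
          θ * (differential I uB b v * differential I uB b w))
      (R := fun q v w ↦ gF.ricci q v w) (k := fun q v w ↦ gF.val q v w) (μ := μ)
      (fun b ↦ by simp only [rB0, hB0, vB0, dB0, mul_zero, sub_zero, add_zero])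
      (fun q ↦ rF0 q 0) (fun q ↦ vF0 q 0) gF.exists_val_ne_zero
    have hsol : (∀ (p : B × F) (v w : EB × EF), W.ricci p v w + W.hessian (hB ∘ Prod.fst) p v w
        - θ * (differential (I.prod J) (uB ∘ Prod.fst) p v *
          differential (I.prod J) (uB ∘ Prod.fst) p w) = lam * W.val p v w) ↔
        (∀ (p : B) (v w : EB), gB.ricci p v w - Module.finrank ℝ EF / f p * gB.hessian f p v w +
          gB.hessian hB p v w - θ * (differential I uB p v * differential I uB p w) =
            lam * gB.val p v w) ∧
        ∃ c : ℝ, gF.IsEinstein c ∧ ∀ b, μ b = c := by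
      refine Iff.trans ?_ (sep.trans (and_congr_left' ?_))
      · refine forall_congr' fun p ↦ forall_congr' fun v ↦ forall_congr' fun w ↦ ?_
        rw [differential_comp_fst huB, differential_comp_fst huB]
        have := tensor p v w
        constructor <;> intro h <;> linarith
      · refine forall_congr' fun p ↦ forall_congr' fun v ↦ forall_congr' fun w ↦ ?_
        constructor <;> intro h <;> linarith
    have hharm : (∀ p : B × F, W.laplacian (uB ∘ Prod.fst) p -
        W.val p (W.grad (uB ∘ Prod.fst) p) (W.grad (hB ∘ Prod.fst) p) = 0) ↔
        ∀ p : B, gB.driftLaplacian (fun x ↦ hB x - Module.finrank ℝ EF * Real.log (f x)) uB p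
          = 0 := by
      simp only [hW, laplacian_warpedProduct_fst gB gF hf hpos huB,
        val_grad_warpedProduct_fst gB gF hf hpos huB hhB,
        driftLaplacian_sub_mul_log gB hf hpos hhB]
      exact ⟨fun h p ↦ h (p, Classical.arbitrary F), fun h p ↦ h p.1⟩
    constructor
    · intro h
      have h1 := hsol.1 h.soliton_eq
      exact ⟨h1.1, hharm.1 h.harmonic_eq, h1.2⟩
    · rintro ⟨h1, h2, h3⟩
      exact ⟨hθ, hh, huB.comp contMDiff_fst, hsol.2 ⟨h1, h3⟩, hharm.2 h2⟩
  · intro uF huF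
    -- Here `du` is vertical, so the `θ` term belongs to the fiber tensor `R`, turning Einstein into
    -- harmonic-Einstein.
    have sep := forall_add_eq_zero_iff_separated (B := B) (F := F) (E := EB) (E' := EF)
      (A := fun b v w ↦ gB.ricci b v w - Module.finrank ℝ EF / f b * gB.hessian f b v w +
        gB.hessian hB b v w - lam * gB.val b v w)
      (R := fun q v w ↦ gF.ricci q v w - θ * (differential J uF q v * differential J uF q w))
      (k := fun q v w ↦ gF.val q v w) (μ := μ)
      (fun b ↦ by simp only [rB0, hB0, vB0, mul_zero, sub_zero, add_zero])
      (fun q ↦ by simp only [rF0, dF0, mul_zero, sub_zero]) (fun q ↦ vF0 q 0)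
      gF.exists_val_ne_zero
    have hsol : (∀ (p : B × F) (v w : EB × EF), W.ricci p v w + W.hessian (hB ∘ Prod.fst) p v w
        - θ * (differential (I.prod J) (uF ∘ Prod.snd) p v *
          differential (I.prod J) (uF ∘ Prod.snd) p w) = lam * W.val p v w) ↔
        (∀ (p : B) (v w : EB), gB.ricci p v w - Module.finrank ℝ EF / f p * gB.hessian f p v w +
          gB.hessian hB p v w = lam * gB.val p v w) ∧
        ∃ c : ℝ, (∀ (q : F) (v w : EF), gF.ricci q v w -
          θ * (differential J uF q v * differential J uF q w) = c * gF.val q v w) ∧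
            ∀ b, μ b = c := by
      refine Iff.trans ?_ (sep.trans (and_congr_left' ?_))
      · refine forall_congr' fun p ↦ forall_congr' fun v ↦ forall_congr' fun w ↦ ?_
        rw [differential_comp_snd huF, differential_comp_snd huF]
        have := tensor p v w
        constructor <;> intro h <;> linarith
      · refine forall_congr' fun p ↦ forall_congr' fun v ↦ forall_congr' fun w ↦ ?_
        constructor <;> intro h <;> linarith
    have hharm : (∀ p : B × F, W.laplacian (uF ∘ Prod.snd) p -
        W.val p (W.grad (uF ∘ Prod.snd) p) (W.grad (hB ∘ Prod.fst) p) = 0) ↔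
        ∀ q : F, gF.laplacian uF q = 0 := by
      simp only [hW, laplacian_warpedProduct_snd gB gF hf hpos huF,
        val_grad_warpedProduct_snd gB gF hf hpos huF hhB, sub_zero]
      -- Any base point may be placed under `q`, and the factor `f⁻²` there is nonzero.
      exact ⟨fun h q ↦ (mul_eq_zero.1 (h (Classical.arbitrary B, q))).resolve_left
        (inv_ne_zero (pow_ne_zero 2 (hpos _).ne')), fun h p ↦ by rw [h, mul_zero]⟩
    constructor
    · intro h
      obtain ⟨h1, c, h2, h3⟩ := hsol.1 h.soliton_eq
      exact ⟨h1, c, ⟨h2, hharm.1 h.harmonic_eq⟩, h3⟩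
    · rintro ⟨h1, c, ⟨h2, h3⟩, h4⟩
      exact ⟨hθ, hh, huF.comp contMDiff_snd, hsol.2 ⟨h1, c, h2, h4⟩, hharm.2 h3⟩
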